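/- Let $W:\mathbb R\to[0,\infty)$ be continuous with $W(s)=0$ if and only if $s=\pm1$, and suppose that for some $c>0$ one has $W(s)\ge c(s-1)^2$ for $s\ge 0$ and $W(s)\ge c(s+1)^2$ for $s\le 0$. Say that $k_0$ is an interpolation constant for $W$ if $$k_0\int_\alpha^\beta (u')^2\,dx\le\frac1{(\beta-\alpha)^2}\int_\alpha^\beta W(u)\,dx+(\beta-\alpha)^2\int_\alpha^\beta (u'')^2\,dx$$ for all real $\alpha<\beta$ and all $u\in W^{2,2}(\alpha,\beta)$. Then $W$ has an interpolation constant $k_0>0$. Moreover, let $k_0>0$ be any interpolation constant for $W$, let $k<k_0$ be real, and let $I=(a,b)$ with $-\infty<a<b<\infty$. For $\varepsilon>0$ and $u\in L^1(I)$ put $$F^k_\varepsilon(u)=\int_I\Big(\frac{W(u)}{\varepsilon}-k\,\varepsilon\,(u')^2+\varepsilon^3(u'')^2\Big)dx\ \text{ if } u\in W^{2,2}(I),\qquad F^k_\varepsilon(u)=+\infty\ \text{ otherwise.}$$ Let $\mathcal A$ be the set of $f\in W^{2,2}_{\rm loc}(\mathbb R)$ such that, for some $T>0$, $f=1$ on $(T,\infty)$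 and $f=-1$ on $(-\infty,-T)$, and put $$\mathbf m_k=\inf_{f\in\mathcal A}\int_{\mathbb R}\big(W(f)-k(f')^2+(f'')^2\big)\,dx .$$ Then $0<\mathbf m_k<\infty$, and as $\varepsilon\to0^+$ the functionals $F^k_\varepsilon$ $\Gamma$-converge in $L^1(I)$ to $$F^k(u)=\mathbf m_k\,\#S(u)\ \text{ if } u\in BV(I;\{\pm1\}),\qquad F^k(u)=+\infty\ \text{ otherwise in } L^1(I),$$ where $S(u)$ is the set of jump points of $u$ in $I$. That is, for every sequence $\varepsilon_j\to0^+$ and every $u\in L^1(I)$: $F^k(u)\le\liminf_j F^k_{\varepsilon_j}(u_j)$ whenever $u_j\to u$ in $L^1(I)$, and there are $u_j\to u$ in $L^1(I)$ with $\limsup_j F^k_{\varepsilon_j}(u_j)\le F^k(u)$. -/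

import Mathlib

open MeasureTheory Set Filter Topology

noncomputable section

namespace ColemanMizel

/-- The admissible double-well potentials: `W : ℝ → [0, ∞)` is continuous, vanishes exactly at
`±1`, and `W s ≥ c (s ∓ 1)²` for `± s ≥ 0`, for some `c > 0`. -/
structure IsDoubleWell (W : ℝ → ℝ) : Prop where
  continuous : Continuous W
  nonneg : ∀ s, 0 ≤ W s
  eq_zero_iff : ∀ s, W s = 0 ↔ s = 1 ∨ s = -1
  growth : ∃ c : ℝ, 0 < c ∧ (∀ s, 0 ≤ s → c * (s - 1) ^ 2 ≤ W s) ∧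
    (∀ s, s ≤ 0 → c * (s + 1) ^ 2 ≤ W s)

/-- `v` is a weak derivative of `u` on the open set `Ω ⊆ ℝ`. -/
def HasWeakDerivOn (Ω : Set ℝ) (u v : ℝ → ℝ) : Prop :=
  LocallyIntegrableOn u Ω ∧ LocallyIntegrableOn v Ω ∧
    ∀ φ : ℝ → ℝ, ContDiff ℝ ((⊤ : ℕ∞) : WithTop ℕ∞) φ → HasCompactSupport φ → tsupport φ ⊆ Ω →
      ∫ x in Ω, u x * deriv φ x = -∫ x in Ω, v x * φ x

open Classical in
/-- A weak derivative of `u` on `Ω` if there is one (it is then unique almost everywhere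
on `Ω`), and `0` otherwise. -/
def weakDeriv (Ω : Set ℝ) (u : ℝ → ℝ) : ℝ → ℝ :=
  if h : ∃ v, HasWeakDerivOn Ω u v then h.choose else 0

/-- `u ∈ W^{2,2}(Ω)`: `u` and its weak derivatives of order one and two are in `L²(Ω)`. -/
def MemW22 (Ω : Set ℝ) (u : ℝ → ℝ) : Prop :=
  MemLp u 2 (volume.restrict Ω) ∧
    ∃ v w : ℝ → ℝ, HasWeakDerivOn Ω u v ∧ HasWeakDerivOn Ω v w ∧
      MemLp v 2 (volume.restrict Ω) ∧ MemLp w 2 (volume.restrict Ω)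

/-- `f ∈ L²_loc(ℝ)`. -/
def MemL2Loc (f : ℝ → ℝ) : Prop :=
  ∀ R : ℝ, MemLp f 2 (volume.restrict (Ioo (-R) R))

/-- `f ∈ W^{2,2}_loc(ℝ)`: `f` and its weak derivatives of order one and two are in
`L²_loc(ℝ)`. -/
def MemW22Loc (f : ℝ → ℝ) : Prop :=
  MemL2Loc f ∧
    ∃ g h : ℝ → ℝ, HasWeakDerivOn univ f g ∧ HasWeakDerivOn univ g h ∧
      MemL2Loc g ∧ MemL2Loc h

/-- The space `L¹(I)` for `I = (a, b)`. -/
abbrev L1 (a b : ℝ) : Type := Lp ℝ 1 (volume.restrict (Ioo a b))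

open Classical in
/-- The Coleman–Mizel functional `F^k_ε : L¹(I) → (-∞, +∞]` on `I = (a, b)`, which is
`∫_I (W(u)/ε - k ε (u')² + ε³ (u'')²)` on `W^{2,2}(I)` and `+∞` elsewhere. (For `u` in
`W^{2,2}(I)` all three terms are integrable, because `u` is bounded and `W` continuous.) -/
def energy (W : ℝ → ℝ) (k a b ε : ℝ) (u : L1 a b) : EReal :=
  if MemW22 (Ioo a b) u then
    ((∫ x in Ioo a b, (W (u x) / ε - k * ε * (weakDeriv (Ioo a b) u x) ^ 2
        + ε ^ 3 * (weakDeriv (Ioo a b) (weakDeriv (Ioo a b) u) x) ^ 2) : ℝ) : EReal)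
  else ⊤

/-- The nonlinear interpolation inequality holds with the constant `k₀`:
`k₀ ∫ₐᵇ (u')² ≤ (b - a)⁻² ∫ₐᵇ W(u) + (b - a)² ∫ₐᵇ (u'')²` for all `a < b`
and all `u ∈ W^{2,2}(a, b)`. -/
def IsInterpolationConstant (W : ℝ → ℝ) (k₀ : ℝ) : Prop :=
  ∀ a b : ℝ, a < b → ∀ u : ℝ → ℝ, MemW22 (Ioo a b) u →
    k₀ * ∫ x in Ioo a b, (weakDeriv (Ioo a b) u x) ^ 2 ≤
      1 / (b - a) ^ 2 * (∫ x in Ioo a b, W (u x)) +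
        (b - a) ^ 2 * ∫ x in Ioo a b, (weakDeriv (Ioo a b) (weakDeriv (Ioo a b) u) x) ^ 2

/-- The class `𝒜` of profiles: functions in `W^{2,2}_loc(ℝ)` that are equal to `1` on `(T, ∞)`
and to `-1` on `(-∞, -T)`, for some `T > 0`. -/
def profiles : Set (ℝ → ℝ) :=
  {f | MemW22Loc f ∧ ∃ T : ℝ, 0 < T ∧ (∀ x, T < x → f x = 1) ∧ (∀ x, x < -T → f x = -1)}

/-- The optimal-profile constant `m_k = inf_{f ∈ 𝒜} ∫_ℝ (W(f) - k (f')² + (f'')²)`, an infimum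
in `[-∞, +∞]`. (For `f ∈ 𝒜` and `W(±1) = 0` the integrand has bounded support and is
integrable.) -/
def optimalProfile (W : ℝ → ℝ) (k : ℝ) : EReal :=
  ⨅ f ∈ profiles,
    ((∫ x, (W (f x) - k * (weakDeriv univ f x) ^ 2
        + (weakDeriv univ (weakDeriv univ f) x) ^ 2) : ℝ) : EReal)

/-- `u ∈ BV(I; {±1})`, `I = (a, b)`: `u` takes the values `±1` almost everywhere on `I`, and it
has a representative of bounded variation on `I`. -/
def MemBVSign {a b : ℝ} (u : L1 a b) : Prop :=
  (∀ᵐ x ∂(volume.restrict (Ioo a b)), u x = 1 ∨ u x = -1) ∧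
    ∃ v : ℝ → ℝ, v =ᵐ[volume.restrict (Ioo a b)] u ∧ BoundedVariationOn v (Ioo a b)

/-- `S(u)`: the points of `I = (a, b)` at which `u` has no approximate limit, that is, no `z` with
`⨍_{(x - r, x + r)} |u - z| → 0` as `r → 0⁺`. For a function in `BV(I)` these are its jumps. -/
def jumpSet {a b : ℝ} (u : L1 a b) : Set ℝ :=
  {x ∈ Ioo a b | ¬ ∃ z : ℝ,
    Tendsto (fun r : ℝ => ⨍ y in Ioo (x - r) (x + r), |u y - z|) (𝓝[>] 0) (𝓝 0)}

open Classical in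
/-- The sharp interface functional `F^k`: `m_k · #S(u)` on `BV(I; {±1})` and `+∞` elsewhere in
`L¹(I)`. -/
def limitEnergy (W : ℝ → ℝ) (k a b : ℝ) (u : L1 a b) : EReal :=
  if MemBVSign u then optimalProfile W k * (((jumpSet u).encard : ENNReal) : EReal) else ⊤

/-- `F ε` Γ-converges to `F₀` as `ε → 0⁺` (in the sequential sense, which in a metric
space is the usual one): for every sequence `ε n → 0⁺`, the liminf inequality holds along every
convergent sequence, and each point has a recovery sequence. -/
def GammaConverges {X : Type*} [TopologicalSpace X] (F : ℝ → X → EReal) (F₀ : X → EReal) : Prop :=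
  ∀ ε : ℕ → ℝ, (∀ n, 0 < ε n) → Tendsto ε atTop (𝓝 0) →
    (∀ (u : X) (v : ℕ → X), Tendsto v atTop (𝓝 u) →
      F₀ u ≤ liminf (fun n => F (ε n) (v n)) atTop) ∧
    (∀ u : X, ∃ v : ℕ → X, Tendsto v atTop (𝓝 u) ∧
      limsup (fun n => F (ε n) (v n)) atTop ≤ F₀ u)

end ColemanMizel

end

/-! The only obstacle is the negative term `-k ε (u')²`, and the interpolation inequality controls
it. On an interval of length `L`, either `u'` is somewhere at most `2 √(L ∫ (u'')²)`, and the
curvature term bounds `∫ (u')²`, or `u'` has one sign and comparable size throughout, so that `u`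
sweeps through its values too fast to stay near the wells and `W(u)` pays
(`exists_isInterpolationConstant`). Cutting a long interval into equal pieces of length close to one
preserves nearly the whole constant `k₀`. As `k < k₀`, on intervals of length at least a fixed
multiple of `ε` the energy dominates a fixed fraction of the energy with `k = -1`, whose terms are
all nonnegative (`exists_coercive`).

Coercivity gives `m_k > 0`: on the way from `0` to `1/2` a profile either spends a long time where
`W ≥ c/4`, or has a large `∫ (f')²` (`transition_lower_bound`).

For the lower bound, bounded energy forces `W(u_j) + (ε_j u_j')² → 0` in `L¹`. Along a subsequence,
at almost every point `u_j` tends to `±1` and `ε_j u_j'` to `0`. On the two sides of the transition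
at a jump of the limit there are two such points with opposite limits. After rescaling, the piece
between them becomes a competitor for `m_k` once two cubic pieces of small energy are attached
(`exists_transition`), so it costs almost `m_k`. The remaining pieces have fixed length, hence
eventually nonnegative energy. Adding up bounds the number of jumps, which also shows that a limit
with finite energy is a piecewise constant function (`card_mul_le`).

For the upper bound, a rescaled, nearly optimal profile is placed at every jump, reflected if the
jump is downward. Profiles reach the wells with zero slope at finite distance, so the copies are
glued without extra energy (`exists_recovery`); a diagonal argument concludes.

Throughout, weak derivatives are traded for triples `IsH2 U V w` of functions on the whole line, and
the jump set for `essJump`, which is meaningful before bounded variation is known. -/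

noncomputable section

namespace ColemanMizel

/-! ### Indefinite integrals and gluing. -/

/-- `F` is an indefinite integral of the locally integrable function `f`. -/
structure IsPrimitive (F f : ℝ → ℝ) : Prop where
  intervalIntegrable : ∀ x y, IntervalIntegrable f volume x y
  sub_eq : ∀ x y, F y - F x = ∫ t in x..y, f t

namespace IsPrimitive

variable {F f : ℝ → ℝ}

theorem eq_add (h : IsPrimitive F f) (x y : ℝ) : F y = F x + ∫ t in x..y, f t := by
  linarith [h.sub_eq x y]

theorem continuous (h : IsPrimitive F f) : Continuous F := by
  have : F = fun y => F 0 + ∫ t in (0 : ℝ)..y, f t := funext fun y => h.eq_add 0 y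
  rw [this]
  exact continuous_const.add (intervalIntegral.continuous_primitive h.intervalIntegrable 0)

theorem hasDerivAt (h : IsPrimitive F f) (hf : Continuous f) (x : ℝ) : HasDerivAt F (f x) x := by
  have : F = fun y => F 0 + ∫ t in (0 : ℝ)..y, f t := funext fun y => h.eq_add 0 y
  rw [this]
  exact (hf.integral_hasStrictDerivAt 0 x).hasDerivAt.const_add _

theorem of_hasDerivAt (h : ∀ x, HasDerivAt F (f x) x) (hf : Continuous f) : IsPrimitive F f where
  intervalIntegrable x y := hf.intervalIntegrable x y
  sub_eq x y := (intervalIntegral.integral_eq_sub_of_hasDerivAt (fun t _ => h t)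
    (hf.intervalIntegrable x y)).symm

theorem locallyIntegrable (h : IsPrimitive F f) : LocallyIntegrable f := by
  rw [locallyIntegrable_iff]
  intro K hK
  obtain ⟨r, hr⟩ := hK.isBounded.subset_closedBall 0
  have h1 := h.intervalIntegrable (-r - 1) r
  by_cases hr0 : 0 ≤ r
  · rw [intervalIntegrable_iff_integrableOn_Ioc_of_le (by linarith)] at h1
    refine h1.mono_set (hr.trans ?_)
    rw [Real.closedBall_eq_Icc]
    intro x hx
    exact ⟨by linarith [hx.1], by linarith [hx.2]⟩
  · rw [Metric.closedBall_eq_empty.2 (not_le.1 hr0)] at hr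
    rw [subset_empty_iff.1 hr]
    exact integrableOn_empty

theorem affine (h : IsPrimitive F f) {c : ℝ} (hc : c ≠ 0) (d : ℝ) :
    IsPrimitive (fun x => F (c * x + d)) (fun x => c * f (c * x + d)) where
  intervalIntegrable x y := by
    have h1 := ((h.intervalIntegrable (c * x + d) (c * y + d)).comp_add_right d).comp_mul_left
      (c := c)
    refine IntervalIntegrable.const_mul ?_ c
    convert h1 using 1 <;> field_simp <;> ring
  sub_eq x y := by
    rw [h.sub_eq, intervalIntegral.integral_const_mul, intervalIntegral.integral_comp_mul_add f hc,
      smul_eq_mul, mul_inv_cancel_left₀ hc]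

theorem const_mul (h : IsPrimitive F f) (c : ℝ) :
    IsPrimitive (fun x => c * F x) (fun x => c * f x) where
  intervalIntegrable x y := (h.intervalIntegrable x y).const_mul c
  sub_eq x y := by rw [intervalIntegral.integral_const_mul, ← h.sub_eq]; ring

end IsPrimitive

/-- The function equal to `f` on `(-∞, c]` and to `g` on `(c, ∞)`. -/
def glue (c : ℝ) (f g : ℝ → ℝ) : ℝ → ℝ := fun x => if x ≤ c then f x else g x

theorem glue_of_le {c x : ℝ} (f g : ℝ → ℝ) (h : x ≤ c) : glue c f g x = f x := if_pos h

theorem glue_of_lt {c x : ℝ} (f g : ℝ → ℝ) (h : c < x) : glue c f g x = g x := if_neg (not_le.2 h)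

theorem intervalIntegrable_glue {c : ℝ} {f g : ℝ → ℝ}
    (hf : ∀ x y, IntervalIntegrable f volume x y) (hg : ∀ x y, IntervalIntegrable g volume x y)
    (x y : ℝ) : IntervalIntegrable (glue c f g) volume x y := by
  have key : ∀ z, IntervalIntegrable (glue c f g) volume c z := by
    intro z
    rcases le_total c z with h | h
    · refine (hg c z).congr ?_
      intro t ht
      rw [uIoc_of_le h] at ht
      exact (glue_of_lt _ _ ht.1).symm
    · refine (hf c z).congr ?_
      intro t ht
      rw [uIoc_of_ge h] at ht
      exact (glue_of_le _ _ ht.2).symm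
  exact (key x).symm.trans (key y)

theorem integral_glue_of_le {c x : ℝ} (f g : ℝ → ℝ) (h : x ≤ c) :
    ∫ t in x..c, glue c f g t = ∫ t in x..c, f t := by
  refine intervalIntegral.integral_congr fun t ht => ?_
  rw [uIcc_of_le h] at ht
  exact glue_of_le _ _ ht.2

theorem integral_glue_of_ge {c x : ℝ} (f g : ℝ → ℝ) (h : c ≤ x) :
    ∫ t in c..x, glue c f g t = ∫ t in c..x, g t := by
  refine intervalIntegral.integral_congr_ae (ae_of_all _ fun t ht => ?_)
  rw [uIoc_of_le h] at ht
  exact glue_of_lt _ _ ht.1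

/-- A jump of the derivative is invisible to the integral, so agreement of the values at `c`
suffices. Used for a function and for its slope, this reduces gluing in `W^{2,2}` to matching values
and slopes. -/
theorem IsPrimitive.glue {F f G g : ℝ → ℝ} (hF : IsPrimitive F f) (hG : IsPrimitive G g) {c : ℝ}
    (h : F c = G c) : IsPrimitive (glue c F G) (glue c f g) := by
  have hi := intervalIntegrable_glue (c := c) hF.intervalIntegrable hG.intervalIntegrable
  have key : ∀ z, ColemanMizel.glue c F G z - F c = ∫ t in c..z, ColemanMizel.glue c f g t := by
    intro z
    rcases le_or_gt z c with hz | hz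
    · rw [intervalIntegral.integral_symm, integral_glue_of_le _ _ hz, glue_of_le _ _ hz,
        ← hF.sub_eq]
      ring
    · rw [integral_glue_of_ge _ _ hz.le, glue_of_lt _ _ hz, ← hG.sub_eq, h]
  refine ⟨hi, fun x y => ?_⟩
  rw [← intervalIntegral.integral_add_adjacent_intervals (hi x c) (hi c y), ← key y,
    intervalIntegral.integral_symm, ← key x]
  ring

/-- The Cauchy–Schwarz inequality against the constant `1`. -/
theorem sq_integral_le {f : ℝ → ℝ} {x y : ℝ} (hxy : x ≤ y) (hf : IntervalIntegrable f volume x y)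
    (hf2 : IntervalIntegrable (fun t => f t ^ 2) volume x y) :
    (∫ t in x..y, f t) ^ 2 ≤ (y - x) * ∫ t in x..y, f t ^ 2 := by
  rcases hxy.eq_or_lt with rfl | hlt
  · simp
  set S := ∫ t in x..y, f t
  have hL : 0 < y - x := sub_pos.2 hlt
  -- `c` is the mean of `f`; nonnegativity of the variance `∫ (f - c)²` is the inequality.
  set c := S / (y - x) with hc
  have h0 : 0 ≤ ∫ t in x..y, (f t - c) ^ 2 :=
    intervalIntegral.integral_nonneg hxy fun t _ => sq_nonneg _
  have h1 : ∫ t in x..y, (f t - c) ^ 2 = (∫ t in x..y, f t ^ 2) - 2 * c * S + (y - x) * c ^ 2 := by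
    have : (fun t => (f t - c) ^ 2) = fun t => (f t ^ 2 - 2 * c * f t) + c ^ 2 := by
      funext t; ring
    rw [this, intervalIntegral.integral_add (hf2.sub (hf.const_mul _)) (by simp),
      intervalIntegral.integral_sub hf2 (hf.const_mul _), intervalIntegral.integral_const_mul,
      intervalIntegral.integral_const, smul_eq_mul]
  rw [h1] at h0
  have h2 : c * (y - x) = S := by rw [hc]; field_simp
  nlinarith

/-! ### Continuously differentiable representatives and the scaling of the energy. -/

/-- `V = U'` and `w = V'`, in the sense of indefinite integrals, with `w` locally square
integrable: `U` is the continuously differentiable representative of a function in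
`W^{2,2}_loc(ℝ)`. -/
structure IsH2 (U V w : ℝ → ℝ) : Prop where
  fst : IsPrimitive U V
  snd : IsPrimitive V w
  sq : ∀ x y, IntervalIntegrable (fun t => w t ^ 2) volume x y

namespace IsH2

variable {U V w U₁ V₁ w₁ U₂ V₂ w₂ : ℝ → ℝ}

theorem affine (h : IsH2 U V w) {c : ℝ} (hc : c ≠ 0) (d : ℝ) :
    IsH2 (fun x => U (c * x + d)) (fun x => c * V (c * x + d)) (fun x => c ^ 2 * w (c * x + d)) where
  fst := h.fst.affine hc d
  snd := by
    have := (h.snd.affine hc d).const_mul c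
    simpa only [← mul_assoc, pow_two] using this
  sq x y := by
    have h1 := ((h.sq (c * x + d) (c * y + d)).comp_add_right d).comp_mul_left (c := c)
    have h2 : (fun t => (c ^ 2 * w (c * t + d)) ^ 2) = fun t => c ^ 4 * (w (c * t + d)) ^ 2 := by
      funext t; ring
    rw [h2]
    refine IntervalIntegrable.const_mul ?_ _
    convert h1 using 1 <;> field_simp <;> ring

theorem glue (h₁ : IsH2 U₁ V₁ w₁) (h₂ : IsH2 U₂ V₂ w₂) {c : ℝ} (hU : U₁ c = U₂ c)
    (hV : V₁ c = V₂ c) : IsH2 (glue c U₁ U₂) (glue c V₁ V₂) (glue c w₁ w₂) where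
  fst := h₁.fst.glue h₂.fst hU
  snd := h₁.snd.glue h₂.snd hV
  sq x y := by
    have : (fun t => ColemanMizel.glue c w₁ w₂ t ^ 2) =
        ColemanMizel.glue c (fun t => w₁ t ^ 2) (fun t => w₂ t ^ 2) := by
      funext t
      unfold ColemanMizel.glue
      split_ifs <;> rfl
    rw [this]
    exact intervalIntegrable_glue h₁.sq h₂.sq x y

theorem const (c : ℝ) : IsH2 (fun _ => c) 0 0 where
  fst := .of_hasDerivAt (fun x => hasDerivAt_const x c) continuous_zero
  snd := .of_hasDerivAt (fun x => hasDerivAt_const x 0) continuous_zero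
  sq x y := (continuous_zero.pow 2).intervalIntegrable x y

theorem of_contDiff (hU : ∀ x, HasDerivAt U (V x) x) (hV : ∀ x, HasDerivAt V (w x) x)
    (hw : Continuous w) : IsH2 U V w where
  fst := .of_hasDerivAt hU (continuous_iff_continuousAt.2 fun x => (hV x).continuousAt)
  snd := .of_hasDerivAt hV hw
  sq x y := (hw.pow 2).intervalIntegrable x y

theorem sq_sub_le (h : IsH2 U V w) {x y : ℝ} (hxy : x ≤ y) :
    (V y - V x) ^ 2 ≤ (y - x) * ∫ t in x..y, w t ^ 2 := by
  rw [h.snd.sub_eq]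
  exact sq_integral_le hxy (h.snd.intervalIntegrable x y) (h.sq x y)

theorem sq_sub_fst_le (h : IsH2 U V w) {x y : ℝ} (hxy : x ≤ y) :
    (U y - U x) ^ 2 ≤ (y - x) * ∫ t in x..y, V t ^ 2 := by
  rw [h.fst.sub_eq]
  exact sq_integral_le hxy (h.fst.intervalIntegrable x y)
    ((h.snd.continuous.pow 2).intervalIntegrable x y)

end IsH2

/-- The energy at scale `ε` on the interval with end points `x` and `y`. -/
def scaledEnergy (W : ℝ → ℝ) (k ε : ℝ) (U V w : ℝ → ℝ) (x y : ℝ) : ℝ :=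
  ∫ t in x..y, (W (U t) / ε - k * ε * V t ^ 2 + ε ^ 3 * w t ^ 2)

theorem IsH2.intervalIntegrable_energy {W U V w : ℝ → ℝ} (hW : Continuous W) (h : IsH2 U V w)
    (p q r x y : ℝ) :
    IntervalIntegrable (fun t => W (U t) / p - q * V t ^ 2 + r * w t ^ 2) volume x y := by
  refine IntervalIntegrable.add ?_ ((h.sq x y).const_mul _)
  exact (((hW.comp h.fst.continuous).div_const _).sub
    (continuous_const.mul (h.snd.continuous.pow 2))).intervalIntegrable x y

theorem scaledEnergy_add {W U V w : ℝ → ℝ} (hW : Continuous W) (h : IsH2 U V w)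
    (k ε x y z : ℝ) : scaledEnergy W k ε U V w x y + scaledEnergy W k ε U V w y z =
      scaledEnergy W k ε U V w x z :=
  intervalIntegral.integral_add_adjacent_intervals (h.intervalIntegrable_energy hW _ _ _ x y)
    (h.intervalIntegrable_energy hW _ _ _ y z)

/-- Change of variables `x = c y + d` with a positive factor `c`. -/
theorem scaledEnergy_affine (W : ℝ → ℝ) (k : ℝ) {ε c : ℝ} (hc : 0 < c)
    (d : ℝ) (U V w : ℝ → ℝ) (x y : ℝ) :
    scaledEnergy W k ε (fun x => U (c * x + d)) (fun x => c * V (c * x + d))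
      (fun x => c ^ 2 * w (c * x + d)) x y =
    scaledEnergy W k (ε * c) U V w (c * x + d) (c * y + d) := by
  unfold scaledEnergy
  have h := intervalIntegral.integral_comp_mul_add (a := x) (b := y)
    (fun t => W (U t) / (ε * c) - k * (ε * c) * V t ^ 2 + (ε * c) ^ 3 * w t ^ 2) hc.ne' d
  rw [smul_eq_mul, eq_inv_mul_iff_mul_eq₀ hc.ne'] at h
  rw [← h, ← intervalIntegral.integral_const_mul]
  refine intervalIntegral.integral_congr fun t _ => ?_
  simp only
  field_simp

/-- Reflection `x = d - y`. -/
theorem scaledEnergy_neg (W : ℝ → ℝ) (k ε : ℝ) (d : ℝ) (U V w : ℝ → ℝ) (x y : ℝ) :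
    scaledEnergy W k ε (fun x => U (-1 * x + d)) (fun x => -1 * V (-1 * x + d))
      (fun x => (-1) ^ 2 * w (-1 * x + d)) x y =
    scaledEnergy W k ε U V w (d - y) (d - x) := by
  unfold scaledEnergy
  have h := intervalIntegral.integral_comp_sub_left (a := x) (b := y)
    (fun t => W (U t) / ε - k * ε * V t ^ 2 + ε ^ 3 * w t ^ 2) d
  rw [← h]
  refine intervalIntegral.integral_congr fun t _ => ?_
  simp only [show -1 * t + d = d - t by ring]
  ring

theorem scaledEnergy_glue {W : ℝ → ℝ} (k ε : ℝ) {c x y : ℝ} (hx : x ≤ c) (hy : c ≤ y)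
    {U₁ V₁ w₁ U₂ V₂ w₂ : ℝ → ℝ} (hW : Continuous W) (h₁ : IsH2 U₁ V₁ w₁) (h₂ : IsH2 U₂ V₂ w₂)
    (hU : U₁ c = U₂ c) (hV : V₁ c = V₂ c) :
    scaledEnergy W k ε (glue c U₁ U₂) (glue c V₁ V₂) (glue c w₁ w₂) x y =
      scaledEnergy W k ε U₁ V₁ w₁ x c + scaledEnergy W k ε U₂ V₂ w₂ c y := by
  rw [← scaledEnergy_add hW (h₁.glue h₂ hU hV) k ε x c y]
  congr 1
  · refine intervalIntegral.integral_congr fun t ht => ?_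
    rw [uIcc_of_le hx] at ht
    simp only [glue_of_le _ _ ht.2]
  · refine intervalIntegral.integral_congr_ae (ae_of_all _ fun t ht => ?_)
    rw [uIoc_of_le hy] at ht
    simp only [glue_of_lt _ _ ht.1]

/-! ### Weak derivatives and their representatives. -/

namespace IsPrimitive

variable {F f : ℝ → ℝ}

theorem ae_deriv_eq (h : IsPrimitive F f) : ∀ᵐ x, deriv F x = f x := by
  filter_upwards [LocallyIntegrable.ae_hasDerivAt_integral h.locallyIntegrable] with x hx
  have : F = fun y => F 0 + ∫ t in (0 : ℝ)..y, f t := funext fun y => h.eq_add 0 y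
  rw [this]
  exact ((hx 0).const_add _).deriv

theorem absolutelyContinuousOnInterval (h : IsPrimitive F f) (x y : ℝ) :
    AbsolutelyContinuousOnInterval F x y := by
  have : F = (fun _ => F x) + fun y => ∫ t in x..y, f t := funext fun y => h.eq_add x y
  rw [this]
  exact (LipschitzOnWith.absolutelyContinuousOnInterval
    ((LipschitzWith.const (F x)).lipschitzOnWith)).add
    ((h.intervalIntegrable x y).absolutelyContinuousOnInterval_intervalIntegral left_mem_uIcc)

end IsPrimitive

theorem tsupport_deriv_subset' (φ : ℝ → ℝ) : tsupport (deriv φ) ⊆ tsupport φ :=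
  closure_minimal support_deriv_subset (isClosed_tsupport _)

theorem setIntegral_mul_eq_integral {Ω : Set ℝ} {φ : ℝ → ℝ} (hφ : tsupport φ ⊆ Ω) (u : ℝ → ℝ) :
    ∫ x in Ω, u x * φ x = ∫ x, u x * φ x :=
  setIntegral_eq_integral_of_forall_compl_eq_zero fun x hx => by
    rw [image_eq_zero_of_notMem_tsupport fun h => hx (hφ h), mul_zero]

theorem IsPrimitive.hasWeakDerivOn {F f : ℝ → ℝ} (h : IsPrimitive F f) (Ω : Set ℝ) :
    HasWeakDerivOn Ω F f := by
  refine ⟨h.continuous.locallyIntegrable.locallyIntegrableOn _,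
    h.locallyIntegrable.locallyIntegrableOn _, fun φ hφ hc hs => ?_⟩
  obtain ⟨r, hr0, hr⟩ := hc.isCompact.isBounded.subset_closedBall_lt 0 0
  rw [Real.closedBall_eq_Icc, zero_sub, zero_add] at hr
  -- The interval exceeds the support by one on each side, so that `φ` vanishes at its end points
  -- and integration by parts leaves no boundary term.
  have hsub : tsupport φ ⊆ Ioc (-(r + 1)) (r + 1) := hr.trans fun x hx =>
    ⟨by linarith [hx.1], by linarith [hx.2]⟩
  rw [setIntegral_mul_eq_integral hs,
    setIntegral_mul_eq_integral ((tsupport_deriv_subset' _).trans hs)]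
  rw [← intervalIntegral.integral_eq_integral_of_support_subset
      ((Function.support_mul_subset_right _ _).trans ((support_deriv_subset).trans hsub)),
    ← intervalIntegral.integral_eq_integral_of_support_subset
      ((Function.support_mul_subset_right _ _).trans ((subset_tsupport _).trans hsub))]
  have hφ1 : AbsolutelyContinuousOnInterval φ (-(r + 1)) (r + 1) :=
    (hφ.of_le (by norm_cast)).contDiffOn.absolutelyContinuousOnInterval
  rw [(h.absolutelyContinuousOnInterval _ _).integral_mul_deriv_eq_deriv_mul hφ1]
  have e1 : φ (r + 1) = 0 := image_eq_zero_of_notMem_tsupport fun hx => by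
    linarith [(hr hx).2]
  have e2 : φ (-(r + 1)) = 0 := image_eq_zero_of_notMem_tsupport fun hx => by
    linarith [(hr hx).1]
  rw [e1, e2, mul_zero, mul_zero, sub_zero, zero_sub]
  congr 1
  refine intervalIntegral.integral_congr_ae ?_
  filter_upwards [h.ae_deriv_eq] with x hx _
  rw [hx]

theorem integrable_mul_of_tsupport_subset {Ω : Set ℝ} {u φ : ℝ → ℝ} (hu : LocallyIntegrableOn u Ω)
    (hφ : Continuous φ) (hc : HasCompactSupport φ) (hs : tsupport φ ⊆ Ω) :
    Integrable (fun x => u x * φ x) := by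
  have h1 : IntegrableOn (fun x => u x * φ x) (tsupport φ) :=
    (hu.integrableOn_compact_subset hs hc.isCompact).mul_continuousOn hφ.continuousOn hc.isCompact
  exact (integrableOn_iff_integrable_of_support_subset
    ((Function.support_mul_subset_right _ _).trans (subset_tsupport _))).1 h1

theorem ae_eq_of_integral_test {Ω : Set ℝ} (hΩ : IsOpen Ω) {u v : ℝ → ℝ}
    (hu : LocallyIntegrableOn u Ω) (hv : LocallyIntegrableOn v Ω)
    (h : ∀ φ : ℝ → ℝ, ContDiff ℝ ((⊤ : ℕ∞) : WithTop ℕ∞) φ → HasCompactSupport φ →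
      tsupport φ ⊆ Ω → ∫ x in Ω, u x * φ x = ∫ x in Ω, v x * φ x) :
    u =ᵐ[volume.restrict Ω] v := by
  have := hΩ.ae_eq_zero_of_integral_contDiff_smul_eq_zero (hu.sub hv) (μ := volume)
    fun φ hφ hc hs => by
      have h1 := h φ hφ hc hs
      rw [setIntegral_mul_eq_integral hs, setIntegral_mul_eq_integral hs] at h1
      have h2 : (fun x => φ x • (u - v) x) = fun x => u x * φ x - v x * φ x := by
        funext x
        simp only [smul_eq_mul, Pi.sub_apply]
        ring
      rw [h2, integral_sub (integrable_mul_of_tsupport_subset hu hφ.continuous hc hs)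
        (integrable_mul_of_tsupport_subset hv hφ.continuous hc hs), h1, sub_self]
  rw [Filter.EventuallyEq, ae_restrict_iff' hΩ.measurableSet]
  filter_upwards [this] with x hx hxΩ
  exact sub_eq_zero.1 (hx hxΩ)

theorem HasWeakDerivOn.unique {Ω : Set ℝ} (hΩ : IsOpen Ω) {u v v' : ℝ → ℝ}
    (h : HasWeakDerivOn Ω u v) (h' : HasWeakDerivOn Ω u v') : v =ᵐ[volume.restrict Ω] v' := by
  refine ae_eq_of_integral_test hΩ h.2.1 h'.2.1 fun φ hφ hc hs => ?_
  have h1 := h.2.2 φ hφ hc hs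
  rw [h'.2.2 φ hφ hc hs] at h1
  exact (neg_injective h1).symm

theorem HasWeakDerivOn.weakDeriv_ae_eq {Ω : Set ℝ} (hΩ : IsOpen Ω) {u v : ℝ → ℝ}
    (h : HasWeakDerivOn Ω u v) : weakDeriv Ω u =ᵐ[volume.restrict Ω] v := by
  have h0 : ∃ v, HasWeakDerivOn Ω u v := ⟨v, h⟩
  have h1 : weakDeriv Ω u = h0.choose := dif_pos h0
  rw [h1]
  exact h0.choose_spec.unique hΩ h

theorem LocallyIntegrableOn.congr_ae {Ω : Set ℝ} (hΩ : IsOpen Ω) {u v : ℝ → ℝ}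
    (h : LocallyIntegrableOn u Ω) (huv : u =ᵐ[volume.restrict Ω] v) : LocallyIntegrableOn v Ω := by
  rw [locallyIntegrableOn_iff hΩ.isLocallyClosed] at h ⊢
  exact fun K hK hc => (h K hK hc).congr (ae_restrict_of_ae_restrict_of_subset hK huv)

theorem HasWeakDerivOn.congr {Ω : Set ℝ} (hΩ : IsOpen Ω) {u v u' v' : ℝ → ℝ}
    (h : HasWeakDerivOn Ω u v) (hu : u =ᵐ[volume.restrict Ω] u')
    (hv : v =ᵐ[volume.restrict Ω] v') : HasWeakDerivOn Ω u' v' := by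
  refine ⟨LocallyIntegrableOn.congr_ae hΩ h.1 hu, LocallyIntegrableOn.congr_ae hΩ h.2.1 hv,
    fun φ hφ hc hs => ?_⟩
  have h1 := h.2.2 φ hφ hc hs
  rw [integral_congr_ae (hu.mono fun x hx => show u x * deriv φ x = u' x * deriv φ x by rw [hx]),
    integral_congr_ae (hv.mono fun x hx => show v x * φ x = v' x * φ x by rw [hx])] at h1
  exact h1

theorem HasWeakDerivOn.mono {Ω Ω' : Set ℝ} (hs : Ω' ⊆ Ω) {u v : ℝ → ℝ}
    (h : HasWeakDerivOn Ω u v) : HasWeakDerivOn Ω' u v := by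
  refine ⟨h.1.mono_set hs, h.2.1.mono_set hs, fun φ hφ hc hφs => ?_⟩
  have h1 := h.2.2 φ hφ hc (hφs.trans hs)
  rw [setIntegral_mul_eq_integral (hφs.trans hs),
    setIntegral_mul_eq_integral ((tsupport_deriv_subset' _).trans (hφs.trans hs))] at h1
  rwa [setIntegral_mul_eq_integral hφs,
    setIntegral_mul_eq_integral ((tsupport_deriv_subset' _).trans hφs)]

theorem HasWeakDerivOn.sub {Ω : Set ℝ} {u v u' v' : ℝ → ℝ}
    (h : HasWeakDerivOn Ω u v) (h' : HasWeakDerivOn Ω u' v') :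
    HasWeakDerivOn Ω (fun x => u x - u' x) (fun x => v x - v' x) := by
  refine ⟨h.1.sub h'.1, h.2.1.sub h'.2.1, fun φ hφ hc hs => ?_⟩
  have hd : Continuous (deriv φ) := hφ.continuous_deriv (by norm_cast)
  have hds := (tsupport_deriv_subset' φ).trans hs
  simp only [sub_mul]
  rw [integral_sub (integrable_mul_of_tsupport_subset h.1 hd hc.deriv hds).integrableOn
      (integrable_mul_of_tsupport_subset h'.1 hd hc.deriv hds).integrableOn,
    integral_sub (integrable_mul_of_tsupport_subset h.2.1 hφ.continuous hc hs).integrableOn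
      (integrable_mul_of_tsupport_subset h'.2.1 hφ.continuous hc hs).integrableOn,
    h.2.2 φ hφ hc hs, h'.2.2 φ hφ hc hs]
  ring

/-- A smooth function with integral zero and compact support in an interval is the derivative of
a smooth function with compact support in this interval. -/
theorem exists_primitive_test {a b : ℝ} {θ : ℝ → ℝ}
    (hθ : ContDiff ℝ ((⊤ : ℕ∞) : WithTop ℕ∞) θ) (hc : HasCompactSupport θ)
    (hs : tsupport θ ⊆ Ioo a b) (h0 : ∫ x, θ x = 0) :
    ∃ φ : ℝ → ℝ, ContDiff ℝ ((⊤ : ℕ∞) : WithTop ℕ∞) φ ∧ HasCompactSupport φ ∧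
      tsupport φ ⊆ Ioo a b ∧ deriv φ = θ := by
  rcases (tsupport θ).eq_empty_or_nonempty with he | hne
  · have : θ = 0 := tsupport_eq_empty_iff.1 he
    refine ⟨0, contDiff_const, HasCompactSupport.zero, by simp, ?_⟩
    rw [this]
    exact deriv_const' 0
  obtain ⟨c, hcl⟩ := hc.isCompact.exists_isLeast hne
  obtain ⟨d, hdg⟩ := hc.isCompact.exists_isGreatest hne
  have hca := hs hcl.1
  have hdb := hs hdg.1
  -- The primitive starting at `a` vanishes to the left of the support of `θ`; to the right of it
  -- because the total integral is zero.
  have hd : ∀ x, HasDerivAt (fun y => ∫ t in a..y, θ t) (θ x) x := fun x =>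
    (hθ.continuous.integral_hasStrictDerivAt a x).hasDerivAt
  have hd' : deriv (fun y => ∫ t in a..y, θ t) = θ := funext fun x => (hd x).deriv
  have hsupp : Function.support (fun y => ∫ t in a..y, θ t) ⊆ Icc c d := by
    intro x hx
    rw [Function.mem_support] at hx
    by_contra hxn
    apply hx
    rw [mem_Icc, not_and_or, not_le, not_le] at hxn
    rcases hxn with hxc | hxd
    · rw [intervalIntegral.integral_congr (g := fun _ => (0 : ℝ)) ?_]
      · simp
      · intro t ht
        have : t < c := ht.2.trans_lt (max_lt hca.1 hxc)
        exact image_eq_zero_of_notMem_tsupport fun h => absurd (hcl.2 h) (not_le.2 this)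
    · rw [intervalIntegral.integral_eq_integral_of_support_subset, h0]
      refine (subset_tsupport θ).trans fun t ht => ⟨(hs ht).1, (hdg.2 ht).trans hxd.le⟩
  have hts : tsupport (fun y => ∫ t in a..y, θ t) ⊆ Icc c d :=
    closure_minimal hsupp isClosed_Icc
  refine ⟨fun y => ∫ t in a..y, θ t, ?_, ?_, ?_, hd'⟩
  · rw [contDiff_infty_iff_deriv, hd']
    exact ⟨fun x => (hd x).differentiableAt, hθ⟩
  · exact HasCompactSupport.of_support_subset_isCompact isCompact_Icc hsupp
  · exact hts.trans fun x hx => ⟨hca.1.trans_le hx.1, hx.2.trans_lt hdb.2⟩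

/-- The lemma of du Bois-Reymond: a function with vanishing weak derivative is constant. -/
theorem HasWeakDerivOn.exists_const {a b : ℝ} (hab : a < b) {u v : ℝ → ℝ}
    (h : HasWeakDerivOn (Ioo a b) u v) (hv : v =ᵐ[volume.restrict (Ioo a b)] 0) :
    ∃ c : ℝ, u =ᵐ[volume.restrict (Ioo a b)] fun _ => c := by
  let B : ContDiffBump ((a + b) / 2) := ⟨(b - a) / 8, (b - a) / 4, by linarith, by linarith⟩
  set ψ : ℝ → ℝ := B.normed volume with hψ
  have hψd : ContDiff ℝ ((⊤ : ℕ∞) : WithTop ℕ∞) ψ := B.contDiff_normed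
  have hψc : HasCompactSupport ψ := B.hasCompactSupport_normed
  have hψs : tsupport ψ ⊆ Ioo a b := by
    rw [hψ, B.tsupport_normed_eq, Real.closedBall_eq_Icc]
    intro x hx
    have h1 : (a + b) / 2 - (b - a) / 4 ≤ x := hx.1
    have h2 : x ≤ (a + b) / 2 + (b - a) / 4 := hx.2
    exact ⟨by linarith, by linarith⟩
  have hψ1 : ∫ x, ψ x = 1 := B.integral_normed
  refine ⟨∫ x in Ioo a b, u x * ψ x, ae_eq_of_integral_test isOpen_Ioo h.1
    ((locallyIntegrable_const _).locallyIntegrableOn _) fun φ hφ hc hs => ?_⟩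
  -- Subtracting a multiple of the unit bump `ψ` makes the mean of `φ` zero, so that `θ` is the
  -- derivative of a test function and is annihilated by `u`. The constant is therefore `∫ u ψ`.
  set θ : ℝ → ℝ := fun x => φ x - (∫ y, φ y) * ψ x with hθ
  have iφ : Integrable φ := hφ.continuous.integrable_of_hasCompactSupport hc
  have iψ : Integrable ψ := hψd.continuous.integrable_of_hasCompactSupport hψc
  have hsub : tsupport θ ⊆ tsupport φ ∪ tsupport ψ := by
    refine closure_minimal ?_ ((isClosed_tsupport _).union (isClosed_tsupport _))
    intro x hx
    by_contra hn
    rw [mem_union, not_or] at hn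
    apply hx
    simp only [hθ, image_eq_zero_of_notMem_tsupport hn.1, image_eq_zero_of_notMem_tsupport hn.2]
    simp
  obtain ⟨χ, hχ, hχc, hχs, hχd⟩ := exists_primitive_test (a := a) (b := b) (θ := θ)
    (hφ.sub (contDiff_const.mul hψd))
    (HasCompactSupport.of_support_subset_isCompact (hc.isCompact.union hψc.isCompact)
      ((subset_tsupport _).trans hsub))
    (hsub.trans (union_subset hs hψs))
    (by
      rw [hθ, integral_sub iφ (iψ.const_mul _), integral_const_mul, hψ1]
      ring)
  have h1 := h.2.2 χ hχ hχc hχs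
  rw [hχd, integral_congr_ae (hv.mono fun x hx =>
    show v x * χ x = 0 by rw [hx]; simp), integral_zero, neg_zero] at h1
  have h2 : (fun x => u x * θ x) = fun x => u x * φ x - (∫ y, φ y) * (u x * ψ x) := by
    funext x
    simp only [hθ]
    ring
  rw [h2, integral_sub
    (integrable_mul_of_tsupport_subset h.1 hφ.continuous hc hs).integrableOn
    ((integrable_mul_of_tsupport_subset h.1 hψd.continuous hψc hψs).const_mul _).integrableOn,
    integral_const_mul, sub_eq_zero] at h1
  have h3 : ∫ x in Ioo a b, φ x = ∫ x, φ x :=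
    setIntegral_eq_integral_of_forall_compl_eq_zero fun x hx =>
      image_eq_zero_of_notMem_tsupport fun h => hx (hs h)
  rw [h1, integral_const_mul, h3, mul_comm]

/-- Two functions with the same weak derivative, the second of which is a primitive, differ by a
constant. -/
theorem HasWeakDerivOn.exists_add_const {a b : ℝ} (hab : a < b) {u v F f : ℝ → ℝ}
    (h : HasWeakDerivOn (Ioo a b) u v) (hF : IsPrimitive F f)
    (hv : v =ᵐ[volume.restrict (Ioo a b)] f) :
    ∃ c : ℝ, u =ᵐ[volume.restrict (Ioo a b)] fun x => F x + c := by
  obtain ⟨c, hc⟩ := (h.sub (hF.hasWeakDerivOn _)).exists_const hab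
    (hv.mono fun x hx => by simp [hx])
  exact ⟨c, hc.mono fun x hx => by linarith⟩

theorem IsPrimitive.add_const {F f : ℝ → ℝ} (h : IsPrimitive F f) (c : ℝ) :
    IsPrimitive (fun x => F x + c) f :=
  ⟨h.intervalIntegrable, fun x y => by rw [← h.sub_eq]; ring⟩

theorem isPrimitive_integral {f : ℝ → ℝ} (hf : ∀ x y, IntervalIntegrable f volume x y) (a : ℝ) :
    IsPrimitive (fun x => ∫ t in a..x, f t) f :=
  ⟨hf, fun x y => intervalIntegral.integral_interval_sub_left (hf a y) (hf a x)⟩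

theorem HasWeakDerivOn.exists_isH2 {a b : ℝ} (hab : a < b) {u v w : ℝ → ℝ}
    (huv : HasWeakDerivOn (Ioo a b) u v) (hvw : HasWeakDerivOn (Ioo a b) v w)
    (hw : MemLp w 2 (volume.restrict (Ioo a b))) :
    ∃ U V w' : ℝ → ℝ, IsH2 U V w' ∧ u =ᵐ[volume.restrict (Ioo a b)] U ∧
      v =ᵐ[volume.restrict (Ioo a b)] V ∧ w =ᵐ[volume.restrict (Ioo a b)] w' := by
  -- Extension by zero makes `w` integrable over the whole line. Integrating it twice gives `V` and
  -- `U`; the two free constants come from the lemma of du Bois-Reymond.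
  set w' : ℝ → ℝ := (Ioo a b).indicator w with hw'
  have e : w =ᵐ[volume.restrict (Ioo a b)] w' :=
    (ae_restrict_iff' measurableSet_Ioo).2 (ae_of_all _ fun x hx => (indicator_of_mem hx w).symm)
  have i1 : Integrable w' := (integrable_indicator_iff measurableSet_Ioo).2
    (hw.integrable (by norm_num))
  have i2 : Integrable fun t => w' t ^ 2 := by
    have : (fun t => w' t ^ 2) = (Ioo a b).indicator fun t => w t ^ 2 := by
      funext t
      by_cases ht : t ∈ Ioo a b <;> simp [hw', ht]
    rw [this]
    exact (integrable_indicator_iff measurableSet_Ioo).2 hw.integrable_sq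
  obtain ⟨c, hc⟩ := hvw.exists_add_const hab
    (isPrimitive_integral (fun x y => i1.intervalIntegrable) a) e
  have hV := (isPrimitive_integral (f := w') (fun x y => i1.intervalIntegrable) a).add_const c
  have hU := isPrimitive_integral (fun x y => hV.continuous.intervalIntegrable x y) a
  obtain ⟨d, hd⟩ := huv.exists_add_const hab hU hc
  exact ⟨_, _, w', ⟨hU.add_const d, hV, fun x y => i2.intervalIntegrable⟩, hd, hc, e⟩

theorem MemW22.exists_isH2 {a b : ℝ} (hab : a < b) {u : ℝ → ℝ} (h : MemW22 (Ioo a b) u) :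
    ∃ U V w : ℝ → ℝ, IsH2 U V w ∧ u =ᵐ[volume.restrict (Ioo a b)] U := by
  obtain ⟨-, v, w, huv, hvw, -, hw⟩ := h
  obtain ⟨U, V, w', h, hu, -, -⟩ := huv.exists_isH2 hab hvw hw
  exact ⟨U, V, w', h, hu⟩

theorem Continuous.memLp_Ioo {f : ℝ → ℝ} (hf : Continuous f) (a b : ℝ) :
    MemLp f 2 (volume.restrict (Ioo a b)) := by
  rw [memLp_two_iff_integrable_sq hf.aestronglyMeasurable]
  exact ((hf.pow 2).locallyIntegrable.integrableOn_isCompact isCompact_Icc).mono_set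
    Ioo_subset_Icc_self

namespace IsH2

variable {U V w : ℝ → ℝ} (h : IsH2 U V w)
include h

theorem memLp_Ioo (a b : ℝ) : MemLp w 2 (volume.restrict (Ioo a b)) := by
  rcases le_or_gt b a with hba | hab
  · rw [Ioo_eq_empty (not_lt.2 hba), Measure.restrict_empty]
    simp
  rw [memLp_two_iff_integrable_sq
    h.snd.locallyIntegrable.aestronglyMeasurable.restrict]
  exact ((intervalIntegrable_iff_integrableOn_Ioc_of_le hab.le).1 (h.sq a b)).mono_set
    Ioo_subset_Ioc_self

theorem memW22 {a b : ℝ} {u : ℝ → ℝ} (hu : u =ᵐ[volume.restrict (Ioo a b)] U) :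
    MemW22 (Ioo a b) u :=
  ⟨(Continuous.memLp_Ioo h.fst.continuous a b).ae_eq hu.symm, V, w,
    (h.fst.hasWeakDerivOn _).congr isOpen_Ioo hu.symm EventuallyEq.rfl, h.snd.hasWeakDerivOn _,
    Continuous.memLp_Ioo h.snd.continuous a b, h.memLp_Ioo a b⟩

theorem weakDeriv_ae_eq {Ω : Set ℝ} (hΩ : IsOpen Ω) {u : ℝ → ℝ}
    (hu : u =ᵐ[volume.restrict Ω] U) : weakDeriv Ω u =ᵐ[volume.restrict Ω] V :=
  ((h.fst.hasWeakDerivOn _).congr hΩ hu.symm EventuallyEq.rfl).weakDeriv_ae_eq hΩ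

theorem weakDeriv_weakDeriv_ae_eq {Ω : Set ℝ} (hΩ : IsOpen Ω) {u : ℝ → ℝ}
    (hu : u =ᵐ[volume.restrict Ω] U) : weakDeriv Ω (weakDeriv Ω u) =ᵐ[volume.restrict Ω] w :=
  ((h.snd.hasWeakDerivOn _).congr hΩ (h.weakDeriv_ae_eq hΩ hu).symm
    EventuallyEq.rfl).weakDeriv_ae_eq hΩ

end IsH2

theorem energy_eq_scaledEnergy {W U V w : ℝ → ℝ} (h : IsH2 U V w) {a b : ℝ} (hab : a ≤ b)
    (k ε : ℝ) {u : L1 a b} (hu : u =ᵐ[volume.restrict (Ioo a b)] U) :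
    energy W k a b ε u = (scaledEnergy W k ε U V w a b : ℝ) := by
  rw [energy, if_pos (h.memW22 hu), scaledEnergy, intervalIntegral.integral_of_le hab,
    integral_Ioc_eq_integral_Ioo]
  congr 1
  refine integral_congr_ae ?_
  filter_upwards [hu, h.weakDeriv_ae_eq isOpen_Ioo hu,
    h.weakDeriv_weakDeriv_ae_eq isOpen_Ioo hu] with x h0 h1 h2
  rw [h0, h1, h2]

/-- Both sides depend only on almost everywhere classes, and every `W^{2,2}` class on a bounded
interval has such a representative; this frees the later arguments from weak derivatives. -/
theorem isInterpolationConstant_iff {W : ℝ → ℝ} {k₀ : ℝ} :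
    IsInterpolationConstant W k₀ ↔ ∀ a b : ℝ, a < b → ∀ U V w : ℝ → ℝ, IsH2 U V w →
      k₀ * ∫ t in a..b, V t ^ 2 ≤
        1 / (b - a) ^ 2 * (∫ t in a..b, W (U t)) + (b - a) ^ 2 * ∫ t in a..b, w t ^ 2 := by
  have key : ∀ a b : ℝ, a < b → ∀ U V w u : ℝ → ℝ, IsH2 U V w →
      u =ᵐ[volume.restrict (Ioo a b)] U →
      (∫ x in Ioo a b, (weakDeriv (Ioo a b) u x) ^ 2 = ∫ t in a..b, V t ^ 2) ∧
      (∫ x in Ioo a b, W (u x) = ∫ t in a..b, W (U t)) ∧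
      (∫ x in Ioo a b, (weakDeriv (Ioo a b) (weakDeriv (Ioo a b) u) x) ^ 2 =
        ∫ t in a..b, w t ^ 2) := by
    intro a b hab U V w u h hu
    simp only [intervalIntegral.integral_of_le hab.le, integral_Ioc_eq_integral_Ioo]
    refine ⟨integral_congr_ae ?_, integral_congr_ae ?_, integral_congr_ae ?_⟩
    · exact (h.weakDeriv_ae_eq isOpen_Ioo hu).mono fun x hx => by simp only [hx]
    · exact hu.mono fun x hx => by simp only [hx]
    · exact (h.weakDeriv_weakDeriv_ae_eq isOpen_Ioo hu).mono fun x hx => by simp only [hx]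
  constructor
  · intro H a b hab U V w h
    have := H a b hab U (h.memW22 EventuallyEq.rfl)
    obtain ⟨e1, e2, e3⟩ := key a b hab U V w U h EventuallyEq.rfl
    rwa [e1, e2, e3] at this
  · intro H a b hab u hu
    obtain ⟨U, V, w, h, hU⟩ := hu.exists_isH2 hab
    obtain ⟨e1, e2, e3⟩ := key a b hab U V w u h hU
    rw [e1, e2, e3]
    exact H a b hab U V w h

/-! ### The interpolation inequality. -/

/-- Two of the three points, `q` and one neighbour, lie on the same side of zero, hence are compared
with the same well. Being `d` apart, they cannot both be close to it. -/
theorem three_point_bound {W : ℝ → ℝ} (h0 : ∀ s, 0 ≤ W s) {c : ℝ} (hc : 0 < c)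
    (h1 : ∀ s, 0 ≤ s → c * (s - 1) ^ 2 ≤ W s) (h2 : ∀ s, s ≤ 0 → c * (s + 1) ^ 2 ≤ W s)
    {p q r d : ℝ} (hd : 0 ≤ d) (hpq : d ≤ q - p) (hqr : d ≤ r - q) :
    c * d ^ 2 / 2 ≤ W p + W q + W r := by
  rcases le_total q 0 with hq | hq
  · have e1 := h2 p (by linarith)
    have e2 := h2 q hq
    have e3 := h0 r
    have e4 : d ^ 2 ≤ (q - p) ^ 2 := by gcongr
    have e5 : d ^ 2 / 2 ≤ (p + 1) ^ 2 + (q + 1) ^ 2 := by nlinarith [sq_nonneg (p + 1 + (q + 1))]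
    have := mul_le_mul_of_nonneg_left e5 hc.le
    linarith
  · have e1 := h1 q hq
    have e2 := h1 r (by linarith)
    have e3 := h0 p
    have e4 : d ^ 2 ≤ (r - q) ^ 2 := by gcongr
    have e5 : d ^ 2 / 2 ≤ (q - 1) ^ 2 + (r - 1) ^ 2 := by nlinarith [sq_nonneg (q - 1 + (r - 1))]
    have := mul_le_mul_of_nonneg_left e5 hc.le
    linarith

theorem integral_le_const_mul {f : ℝ → ℝ} {x y C : ℝ} (hxy : x ≤ y)
    (hf : IntervalIntegrable f volume x y) (h : ∀ t ∈ Icc x y, f t ≤ C) :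
    ∫ t in x..y, f t ≤ (y - x) * C := by
  have := intervalIntegral.integral_mono_on hxy hf intervalIntegrable_const h
  simpa using this

theorem const_mul_le_integral {f : ℝ → ℝ} {x y C : ℝ} (hxy : x ≤ y)
    (hf : IntervalIntegrable f volume x y) (h : ∀ t ∈ Icc x y, C ≤ f t) :
    (y - x) * C ≤ ∫ t in x..y, f t := by
  have := intervalIntegral.integral_mono_on hxy intervalIntegrable_const hf h
  simpa using this

/-- `V` stays within `m / 2` of a number of modulus `m`, so it keeps its sign and has modulus at
least `m / 2`. -/
theorem IsH2.exists_slope {U V w : ℝ → ℝ} (h : IsH2 U V w) {a b m : ℝ}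
    (hV : ∀ x ∈ Icc a b, |V x - V a| ≤ m / 2) (hm : |V a| = m) :
    (∀ x ∈ Icc a b, ∀ y ∈ Icc a b, x ≤ y → (y - x) * (m / 2) ≤ U y - U x) ∨
    (∀ x ∈ Icc a b, ∀ y ∈ Icc a b, x ≤ y → (y - x) * (m / 2) ≤ U x - U y) := by
  rcases le_total 0 (V a) with h0 | h0
  · left
    intro x hx y hy hxy
    rw [h.fst.sub_eq]
    refine const_mul_le_integral hxy (h.fst.intervalIntegrable x y) fun t ht => ?_
    have := abs_le.1 (hV t ⟨hx.1.trans ht.1, ht.2.trans hy.2⟩)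
    rw [abs_of_nonneg h0] at hm
    linarith [this.1]
  · right
    intro x hx y hy hxy
    have e : U x - U y = ∫ t in x..y, -V t := by
      rw [intervalIntegral.integral_neg, ← h.fst.sub_eq]; ring
    rw [e]
    refine const_mul_le_integral hxy (h.fst.intervalIntegrable x y).neg fun t ht => ?_
    have := abs_le.1 (hV t ⟨hx.1.trans ht.1, ht.2.trans hy.2⟩)
    rw [abs_of_nonpos h0] at hm
    linarith [this.2]

theorem IsDoubleWell.exists_isInterpolationConstant {W : ℝ → ℝ} (hW : IsDoubleWell W) :
    ∃ k₀ : ℝ, 0 < k₀ ∧ IsInterpolationConstant W k₀ := by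
  obtain ⟨c, hc, h1, h2⟩ := hW.growth
  -- `1 / 9` serves the case of a small slope, where `|V| ≤ 3 D`. `c / 486` serves the other, with
  -- `486 = 27 · 8 · 9/4`: here `27` comes from `r³ = (L/3)³`, `8` from the three-point bound with
  -- `d = r m / 2`, and `9/4` from `|V| ≤ 3 m / 2`.
  refine ⟨min (1 / 9) (c / 486), by positivity, isInterpolationConstant_iff.2 ?_⟩
  intro a b hab U V w h
  set k₀ := min (1 / 9) (c / 486) with hk₀
  have hk0 : 0 ≤ k₀ := by positivity
  have hk1 : k₀ ≤ 1 / 9 := min_le_left _ _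
  have hk2 : k₀ ≤ c / 486 := min_le_right _ _
  set L := b - a with hL
  have hL0 : 0 < L := sub_pos.2 hab
  set A := ∫ t in a..b, w t ^ 2 with hA
  have hA0 : 0 ≤ A := intervalIntegral.integral_nonneg hab.le fun t _ => sq_nonneg _
  have hWc : Continuous fun t => W (U t) := hW.continuous.comp h.fst.continuous
  have hB0 : 0 ≤ ∫ t in a..b, W (U t) :=
    intervalIntegral.integral_nonneg hab.le fun t _ => hW.nonneg _
  have hVi : ∀ x y, IntervalIntegrable (fun t => V t ^ 2) volume x y := fun x y =>
    (h.snd.continuous.pow 2).intervalIntegrable x y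
  -- By Cauchy–Schwarz `D` bounds the oscillation of `V` on the interval.
  set D := √(L * A) with hD
  have hD2 : D ^ 2 = L * A := Real.sq_sqrt (by positivity)
  have hD0 : 0 ≤ D := Real.sqrt_nonneg _
  have hosc' : ∀ x ∈ Icc a b, ∀ y ∈ Icc a b, x ≤ y → |V y - V x| ≤ D := by
    intro x hx y hy hxy
    refine abs_le_of_sq_le_sq ?_ hD0
    rw [hD2]
    refine (h.sq_sub_le hxy).trans ?_
    refine mul_le_mul (by linarith [hx.1, hy.2]) ?_
      (intervalIntegral.integral_nonneg hxy fun t _ => sq_nonneg _) hL0.le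
    exact intervalIntegral.integral_mono_interval hx.1 hxy hy.2
      (ae_of_all _ fun t => sq_nonneg _) (h.sq a b)
  have hosc : ∀ x ∈ Icc a b, ∀ y ∈ Icc a b, |V y - V x| ≤ D := by
    intro x hx y hy
    rcases le_total x y with hxy | hxy
    · exact hosc' x hx y hy hxy
    · rw [abs_sub_comm]; exact hosc' y hy x hx hxy
  by_cases hcase : ∃ x ∈ Icc a b, |V x| ≤ 2 * D
  · obtain ⟨x₀, hx₀, hx₀D⟩ := hcase
    have e1 : ∫ t in a..b, V t ^ 2 ≤ L * (9 * (L * A)) := by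
      refine integral_le_const_mul hab.le (hVi a b) fun t ht => ?_
      have e2 : |V t| ≤ 3 * D := by
        have := abs_add_le (V t - V x₀) (V x₀)
        rw [sub_add_cancel] at this
        linarith [hosc x₀ hx₀ t ht]
      calc V t ^ 2 = |V t| ^ 2 := (sq_abs _).symm
        _ ≤ (3 * D) ^ 2 := by gcongr
        _ = 9 * (L * A) := by rw [mul_pow, hD2]; norm_num
    calc k₀ * ∫ t in a..b, V t ^ 2 ≤ k₀ * (L * (9 * (L * A))) := by gcongr
      _ ≤ 1 / 9 * (L * (9 * (L * A))) := by gcongr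
      _ = L ^ 2 * A := by ring
      _ ≤ 1 / L ^ 2 * (∫ t in a..b, W (U t)) + L ^ 2 * A := by
        have : 0 ≤ 1 / L ^ 2 * (∫ t in a..b, W (U t)) := by positivity
        linarith
  · push Not at hcase
    have ha : a ∈ Icc a b := ⟨le_rfl, hab.le⟩
    set m := |V a| with hm
    have hm0 : 2 * D < m := hcase a ha
    have hmp : 0 ≤ m := abs_nonneg _
    set r := L / 3 with hr
    have hr0 : 0 < r := by positivity
    have e1 : ∫ t in a..b, V t ^ 2 ≤ L * (9 / 4 * m ^ 2) := by
      refine integral_le_const_mul hab.le (hVi a b) fun t ht => ?_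
      have e2 : |V t| ≤ 3 / 2 * m := by
        have := abs_add_le (V t - V a) (V a)
        rw [sub_add_cancel] at this
        linarith [hosc a ha t ht]
      calc V t ^ 2 = |V t| ^ 2 := (sq_abs _).symm
        _ ≤ (3 / 2 * m) ^ 2 := by gcongr
        _ = 9 / 4 * m ^ 2 := by ring
    have e2 : ∀ t ∈ Icc a (a + r),
        c * (r * (m / 2)) ^ 2 / 2 ≤ W (U t) + W (U (t + r)) + W (U (t + 2 * r)) := by
      intro t ht
      have hb : b = a + 3 * r := by rw [hr, hL]; ring
      have t0 : t ∈ Icc a b := ⟨ht.1, by linarith [ht.2]⟩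
      have t1 : t + r ∈ Icc a b := ⟨by linarith [ht.1], by linarith [ht.2]⟩
      have t2 : t + 2 * r ∈ Icc a b := ⟨by linarith [ht.1], by linarith [ht.2]⟩
      rcases h.exists_slope (a := a) (b := b) (m := m)
        (fun x hx => (hosc a ha x hx).trans (by linarith)) rfl with H | H
      · have s1 := H _ t0 _ t1 (by linarith)
        have s2 := H _ t1 _ t2 (by linarith)
        rw [add_sub_cancel_left] at s1
        rw [show t + 2 * r - (t + r) = r by ring] at s2
        exact three_point_bound hW.nonneg hc h1 h2 (by positivity) s1 s2
      · have s1 := H _ t0 _ t1 (by linarith)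
        have s2 := H _ t1 _ t2 (by linarith)
        rw [add_sub_cancel_left] at s1
        rw [show t + 2 * r - (t + r) = r by ring] at s2
        have := three_point_bound hW.nonneg hc h1 h2 (by positivity) s2 s1
        linarith
    -- The three thirds of the interval are folded onto the first one, where the three-point bound
    -- holds pointwise.
    have e3 : ∫ t in a..b, W (U t) =
        ∫ t in a..(a + r), (W (U t) + W (U (t + r)) + W (U (t + 2 * r))) := by
      have c1 : Continuous fun t => W (U (t + r)) := hWc.comp (continuous_add_const r)
      have c2 : Continuous fun t => W (U (t + 2 * r)) := hWc.comp (continuous_add_const (2 * r))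
      have c3 : Continuous fun t => W (U t) + W (U (t + r)) := hWc.add c1
      rw [intervalIntegral.integral_add (c3.intervalIntegrable _ _)
          (c2.intervalIntegrable _ _),
        intervalIntegral.integral_add (hWc.intervalIntegrable _ _) (c1.intervalIntegrable _ _),
        intervalIntegral.integral_comp_add_right (fun t => W (U t)),
        intervalIntegral.integral_comp_add_right (fun t => W (U t)),
        show a + r + r = a + 2 * r by ring,
        intervalIntegral.integral_add_adjacent_intervals (hWc.intervalIntegrable _ _)
          (hWc.intervalIntegrable _ _),
        show a + r + 2 * r = b by rw [hr, hL]; ring,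
        intervalIntegral.integral_add_adjacent_intervals (hWc.intervalIntegrable _ _)
          (hWc.intervalIntegrable _ _)]
    have e4 : r * (c * (r * (m / 2)) ^ 2 / 2) ≤ ∫ t in a..b, W (U t) := by
      rw [e3]
      have := const_mul_le_integral (x := a) (y := a + r) (by linarith)
        (Continuous.intervalIntegrable (((hWc.add (hWc.comp (continuous_add_const r))).add
          (hWc.comp (continuous_add_const (2 * r))))) a (a + r)) e2
      rwa [add_sub_cancel_left] at this
    calc k₀ * ∫ t in a..b, V t ^ 2 ≤ k₀ * (L * (9 / 4 * m ^ 2)) := by gcongr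
      _ ≤ c / 486 * (L * (9 / 4 * m ^ 2)) := by gcongr
      _ = 1 / L ^ 2 * (r * (c * (r * (m / 2)) ^ 2 / 2)) := by rw [hr]; field_simp; ring
      _ ≤ 1 / L ^ 2 * ∫ t in a..b, W (U t) := by gcongr
      _ ≤ 1 / L ^ 2 * (∫ t in a..b, W (U t)) + L ^ 2 * A := by
        have : 0 ≤ L ^ 2 * A := by positivity
        linarith

/-! ### Coercivity on long intervals. -/

/-- The inequality is summed over `N` equal pieces; the weights then involve the length of a piece
instead of that of the whole interval. -/
theorem IsInterpolationConstant.subdivide {W : ℝ → ℝ} (hW : Continuous W) {k₀ : ℝ}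
    (hk : IsInterpolationConstant W k₀) {U V w : ℝ → ℝ} (h : IsH2 U V w) {x y : ℝ} (hxy : x < y)
    {N : ℕ} (hN : 0 < N) :
    k₀ * ∫ t in x..y, V t ^ 2 ≤ 1 / ((y - x) / N) ^ 2 * (∫ t in x..y, W (U t)) +
      ((y - x) / N) ^ 2 * ∫ t in x..y, w t ^ 2 := by
  rw [isInterpolationConstant_iff] at hk
  have hN' : (0 : ℝ) < N := Nat.cast_pos.2 hN
  set d := (y - x) / N with hd
  have hd0 : 0 < d := div_pos (sub_pos.2 hxy) hN'
  let p : ℕ → ℝ := fun i => x + i * d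
  have hp0 : p 0 = x := by simp [p]
  have hpN : p N = y := by
    simp only [p, hd]
    field_simp
    ring
  have key : ∀ f : ℝ → ℝ, (∀ x y, IntervalIntegrable f volume x y) →
      ∫ t in x..y, f t = ∑ i ∈ Finset.range N, ∫ t in p i..p (i + 1), f t := by
    intro f hf
    rw [intervalIntegral.sum_integral_adjacent_intervals fun i _ => hf _ _, hp0, hpN]
  rw [key (fun t => V t ^ 2) fun x y => (h.snd.continuous.pow 2).intervalIntegrable x y,
    key (fun t => W (U t)) fun x y => (hW.comp h.fst.continuous).intervalIntegrable x y,
    key (fun t => w t ^ 2) h.sq,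
    Finset.mul_sum, Finset.mul_sum, Finset.mul_sum, ← Finset.sum_add_distrib]
  refine Finset.sum_le_sum fun i _ => ?_
  have e : p (i + 1) - p i = d := by simp only [p]; push_cast; ring
  have := hk (p i) (p (i + 1)) (by linarith) U V w h
  rwa [e] at this

theorem scaledEnergy_one {W U V w : ℝ → ℝ} (hW : Continuous W) (h : IsH2 U V w) (k x y : ℝ) :
    scaledEnergy W k 1 U V w x y = (∫ t in x..y, W (U t)) - k * (∫ t in x..y, V t ^ 2) +
      ∫ t in x..y, w t ^ 2 := by
  have i1 : IntervalIntegrable (fun t => W (U t)) volume x y :=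
    (hW.comp h.fst.continuous).intervalIntegrable x y
  have i2 : IntervalIntegrable (fun t => k * V t ^ 2) volume x y :=
    (continuous_const.mul (h.snd.continuous.pow 2)).intervalIntegrable x y
  rw [scaledEnergy, ← intervalIntegral.integral_const_mul, ← intervalIntegral.integral_sub i1 i2,
    ← intervalIntegral.integral_add (i1.sub i2) (h.sq x y)]
  simp

theorem IsDoubleWell.exists_coercive_one {W : ℝ → ℝ} (hW : IsDoubleWell W) {k₀ k : ℝ}
    (hk₀ : 0 < k₀) (hk : IsInterpolationConstant W k₀) (hkk : k < k₀) :
    ∃ η L : ℝ, 0 < η ∧ 0 < L ∧ ∀ U V w : ℝ → ℝ, IsH2 U V w → ∀ x y : ℝ, L ≤ y - x →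
      η * scaledEnergy W (-1) 1 U V w x y ≤ scaledEnergy W k 1 U V w x y := by
  -- Raising `k` only lowers the energy, so a positive `k₁` still below `k₀` may replace it; `k₂`
  -- leaves room on either side.
  set k₁ := max k (k₀ / 2) with hk₁
  have hk₁0 : 0 < k₁ := lt_max_of_lt_right (by linarith)
  have hk₁k : k₁ < k₀ := max_lt hkk (by linarith)
  set k₂ := (k₁ + k₀) / 2 with hk₂
  have hk₂0 : 0 < k₂ := by linarith
  -- Chosen so that `(1 - η) k₂ = k₁ + η`: the fraction `1 - η` of the two positive terms absorbs
  -- `k₁ ∫ V²` and leaves `η ∫ V²`.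
  set η := (k₂ - k₁) / (1 + k₂) with hη
  have hη0 : 0 < η := div_pos (by linarith) (by linarith)
  have hη1 : η ≤ 1 := (div_le_one (by linarith)).2 (by linarith)
  have hηe : η * (1 + k₂) = k₂ - k₁ := by rw [hη]; field_simp
  -- With `⌊l⌋` pieces the length `d` of a piece is at least one and tends to one, so the loss
  -- factor `d⁻²` is eventually harmless.
  have ht : Tendsto (fun L : ℝ => k₀ * ((⌊L⌋₊ : ℝ) / L) ^ 2) atTop (𝓝 (k₀ * 1 ^ 2)) :=
    (tendsto_nat_floor_div_atTop.pow 2).const_mul _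
  obtain ⟨L, hL⟩ := eventually_atTop.1
    (ht.eventually (lt_mem_nhds (show k₂ < k₀ * 1 ^ 2 by rw [one_pow, mul_one]; linarith)))
  refine ⟨η, max L 1, hη0, by positivity, fun U V w h x y hxy => ?_⟩
  set l := y - x with hl
  have hl1 : 1 ≤ l := (le_max_right _ _).trans hxy
  have hN : 0 < ⌊l⌋₊ := Nat.floor_pos.2 hl1
  have hN' : (0 : ℝ) < ⌊l⌋₊ := Nat.cast_pos.2 hN
  have hlt : x < y := by linarith
  have h1 := hk.subdivide hW.continuous h hlt hN
  have h2 := hL l ((le_max_left _ _).trans hxy)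
  rw [scaledEnergy_one hW.continuous h, scaledEnergy_one hW.continuous h]
  rw [← hl] at h1
  set d := l / ⌊l⌋₊ with hd
  have hd1 : 1 ≤ d := (one_le_div hN').2 (Nat.floor_le (by linarith))
  have hdinv : (⌊l⌋₊ : ℝ) / l = d⁻¹ := by rw [hd, inv_div]
  rw [hdinv] at h2
  set P := ∫ t in x..y, W (U t)
  set Q := ∫ t in x..y, V t ^ 2
  set R := ∫ t in x..y, w t ^ 2
  have hP : 0 ≤ P := intervalIntegral.integral_nonneg hlt.le fun t _ => hW.nonneg _
  have hQ : 0 ≤ Q := intervalIntegral.integral_nonneg hlt.le fun t _ => sq_nonneg _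
  have hR : 0 ≤ R := intervalIntegral.integral_nonneg hlt.le fun t _ => sq_nonneg _
  have hi1 : d⁻¹ ^ 2 ≤ 1 := pow_le_one₀ (by positivity) (inv_le_one_of_one_le₀ hd1)
  have h3 : k₂ * Q ≤ P + R := by
    calc k₂ * Q ≤ k₀ * d⁻¹ ^ 2 * Q := by gcongr
      _ = d⁻¹ ^ 2 * (k₀ * Q) := by ring
      _ ≤ d⁻¹ ^ 2 * (1 / d ^ 2 * P + d ^ 2 * R) := by gcongr
      _ = d⁻¹ ^ 2 * d⁻¹ ^ 2 * P + R := by field_simp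
      _ ≤ 1 * 1 * P + R := by gcongr
      _ = P + R := by ring
  have h4 : k * Q ≤ k₁ * Q := by gcongr; exact le_max_left _ _
  have h5 : (1 - η) * (k₂ * Q) ≤ (1 - η) * (P + R) :=
    mul_le_mul_of_nonneg_left h3 (by linarith)
  have h6 : (1 - η) * (k₂ * Q) = k₁ * Q + η * Q := by linear_combination (-Q) * hηe
  linarith

/-- Coercivity of the energy on intervals that are long in comparison with `ε`. -/
theorem IsDoubleWell.exists_coercive {W : ℝ → ℝ} (hW : IsDoubleWell W) {k₀ k : ℝ}
    (hk₀ : 0 < k₀) (hk : IsInterpolationConstant W k₀) (hkk : k < k₀) :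
    ∃ η L : ℝ, 0 < η ∧ 0 < L ∧ ∀ U V w : ℝ → ℝ, IsH2 U V w → ∀ ε x y : ℝ, 0 < ε →
      L * ε ≤ y - x →
      η * scaledEnergy W (-1) ε U V w x y ≤ scaledEnergy W k ε U V w x y := by
  obtain ⟨η, L, hη, hL, H⟩ := hW.exists_coercive_one hk₀ hk hkk
  refine ⟨η, L, hη, hL, fun U V w h ε x y hε hxy => ?_⟩
  -- The substitution `x = ε y` turns scale `ε` into scale one, and the length condition into `L ≤
  -- (y - x) / ε`.
  have h1 := H _ _ _ (h.affine hε.ne' 0) (x / ε) (y / ε) (by rwa [← sub_div, le_div_iff₀ hε])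
  rw [scaledEnergy_affine W _ hε, scaledEnergy_affine W _ hε, one_mul, add_zero, add_zero,
    mul_div_cancel₀ _ hε.ne', mul_div_cancel₀ _ hε.ne'] at h1
  exact h1

/-! ### Profiles and the bounds `0 < m_k < ∞`. -/

/-- `U` is an admissible profile with derivatives `V` and `w`, and the transition takes place
in `[s, t]`. -/
structure IsProfile (U V w : ℝ → ℝ) (s t : ℝ) : Prop where
  isH2 : IsH2 U V w
  le : s ≤ t
  left : ∀ x ≤ s, U x = -1 ∧ V x = 0 ∧ w x = 0
  right : ∀ x, t < x → U x = 1 ∧ V x = 0 ∧ w x = 0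

namespace IsProfile

variable {U V w : ℝ → ℝ} {s t : ℝ}

theorem mono (h : IsProfile U V w s t) {s' t' : ℝ} (hs : s' ≤ s) (ht : t ≤ t') :
    IsProfile U V w s' t' :=
  ⟨h.isH2, hs.trans (h.le.trans ht), fun x hx => h.left x (hx.trans hs),
    fun x hx => h.right x (ht.trans_lt hx)⟩

/-- Zero slopes at the wells allow a transition on `[s, t]` to be continued by constants; every
competitor is built in this way. -/
theorem of_isH2 (h : IsH2 U V w) (hst : s ≤ t) (hU : U s = -1) (hV : V s = 0) (hU' : U t = 1)
    (hV' : V t = 0) : IsProfile (glue s (fun _ => -1) (glue t U fun _ => 1))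
      (glue s 0 (glue t V 0)) (glue s 0 (glue t w 0)) s t where
  isH2 := (IsH2.const (-1)).glue (h.glue (IsH2.const 1) hU' hV')
    (by rw [glue_of_le _ _ hst, hU]) (by rw [glue_of_le _ _ hst, hV]; rfl)
  le := hst
  left x hx := by simp [glue_of_le _ _ hx]
  right x hx := by simp [glue_of_lt _ _ hx, glue_of_lt _ _ (hst.trans_lt hx)]

theorem mem_profiles (h : IsProfile U V w s t) : U ∈ profiles := by
  refine ⟨⟨fun R => Continuous.memLp_Ioo h.isH2.fst.continuous _ _, V, w,
    h.isH2.fst.hasWeakDerivOn _, h.isH2.snd.hasWeakDerivOn _,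
    fun R => Continuous.memLp_Ioo h.isH2.snd.continuous _ _, fun R => h.isH2.memLp_Ioo _ _⟩,
    max 1 (max (-s) t), by positivity, fun x hx => (h.right x ?_).1, fun x hx => (h.left x ?_).1⟩
  · exact (le_max_right _ _).trans_lt ((le_max_right _ _).trans_lt hx)
  · have h1 : -s ≤ max 1 (max (-s) t) := (le_max_left _ _).trans (le_max_right _ _)
    linarith

theorem integral_eq (h : IsProfile U V w s t) {W : ℝ → ℝ} (hW : IsDoubleWell W) (k : ℝ)
    {f : ℝ → ℝ} (hf : f =ᵐ[volume] U) :
    ∫ x, (W (f x) - k * (weakDeriv univ f x) ^ 2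
        + (weakDeriv univ (weakDeriv univ f) x) ^ 2) = scaledEnergy W k 1 U V w s t := by
  have hf' : f =ᵐ[volume.restrict univ] U := by rwa [Measure.restrict_univ]
  have h1 := h.isH2.weakDeriv_ae_eq isOpen_univ hf'
  have h2 := h.isH2.weakDeriv_weakDeriv_ae_eq isOpen_univ hf'
  rw [Measure.restrict_univ] at h1 h2
  have e : ∫ x, (W (f x) - k * (weakDeriv univ f x) ^ 2
        + (weakDeriv univ (weakDeriv univ f) x) ^ 2) =
      ∫ x, (W (U x) / 1 - k * 1 * V x ^ 2 + 1 ^ 3 * w x ^ 2) := by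
    refine integral_congr_ae ?_
    filter_upwards [hf, h1, h2] with x e0 e1 e2
    rw [e0, e1, e2]
    ring
  rw [e, scaledEnergy]
  symm
  refine intervalIntegral.integral_eq_integral_of_support_subset fun x hx => ?_
  by_contra hn
  apply hx
  rw [mem_Ioc, not_and_or, not_lt, not_le] at hn
  rcases hn with hn | hn
  · obtain ⟨e0, e1, e2⟩ := h.left x hn
    simp [e0, e1, e2, (hW.eq_zero_iff (-1)).2 (Or.inr rfl)]
  · obtain ⟨e0, e1, e2⟩ := h.right x hn
    simp [e0, e1, e2, (hW.eq_zero_iff 1).2 (Or.inl rfl)]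

theorem optimalProfile_le (h : IsProfile U V w s t) {W : ℝ → ℝ} (hW : IsDoubleWell W) (k : ℝ) :
    optimalProfile W k ≤ (scaledEnergy W k 1 U V w s t : ℝ) := by
  rw [← h.integral_eq hW k EventuallyEq.rfl]
  exact iInf₂_le U h.mem_profiles

end IsProfile

/-- Two continuous functions that agree almost everywhere on an open interval agree there
everywhere, so the slope vanishes too. This supplies the matching conditions for truncating a weak
profile. -/
theorem eqOn_of_ae_eq_const {U V w f : ℝ → ℝ} (h : IsH2 U V w) {a b c : ℝ}
    (hfU : f =ᵐ[volume.restrict (Ioo a b)] U) (hf : ∀ x ∈ Ioo a b, f x = c) :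
    ∀ x ∈ Ioo a b, U x = c ∧ V x = 0 := by
  have h1 : EqOn U (fun _ => c) (Ioo a b) := by
    refine Measure.eqOn_open_of_ae_eq (μ := volume) ?_ isOpen_Ioo h.fst.continuous.continuousOn
      continuousOn_const
    filter_upwards [hfU, ae_restrict_mem measurableSet_Ioo] with x hx hm
    rw [← hx, hf x hm]
  refine fun x hx => ⟨h1 hx, ?_⟩
  have h2 : HasDerivAt U 0 x := (hasDerivAt_const x c).congr_of_eventuallyEq
    (h1.eventuallyEq_of_mem (isOpen_Ioo.mem_nhds hx))
  exact (h.fst.hasDerivAt h.snd.continuous x).unique h2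

theorem exists_isProfile {f : ℝ → ℝ} (hf : f ∈ profiles) :
    ∃ U V w s t, IsProfile U V w s t ∧ f =ᵐ[volume] U := by
  obtain ⟨⟨-, g, h, hfg, hgh, -, hh⟩, T, hT, hr, hl⟩ := hf
  obtain ⟨U, V, w, hH, hfU, -, -⟩ := (hfg.mono (subset_univ (Ioo (-(T + 1)) (T + 1)))).exists_isH2
    (by linarith) (hgh.mono (subset_univ _)) (hh (T + 1))
  have h1 := eqOn_of_ae_eq_const hH (a := -(T + 1)) (b := -T) (c := -1)
    (ae_restrict_of_ae_restrict_of_subset (Ioo_subset_Ioo le_rfl (by linarith)) hfU)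
    (fun x hx => hl x hx.2) (-(T + 1 / 2)) ⟨by linarith, by linarith⟩
  have h2 := eqOn_of_ae_eq_const hH (a := T) (b := T + 1) (c := 1)
    (ae_restrict_of_ae_restrict_of_subset (Ioo_subset_Ioo (by linarith) le_rfl) hfU)
    (fun x hx => hr x hx.1) (T + 1 / 2) ⟨by linarith, by linarith⟩
  -- The representative is available on `(-(T + 1), T + 1)` only. The cuts at `±(T + 1/2)` lie
  -- inside this interval and beyond `±T`, where it already rests at the wells.
  have hst : -(T + 1 / 2) ≤ T + 1 / 2 := by linarith
  refine ⟨_, _, _, _, _, IsProfile.of_isH2 hH hst h1.1 h1.2 h2.1 h2.2, ?_⟩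
  rw [Filter.EventuallyEq, ae_restrict_iff' measurableSet_Ioo] at hfU
  filter_upwards [hfU] with x hx
  rcases le_or_gt x (-(T + 1 / 2)) with hx1 | hx1
  · rw [glue_of_le _ _ hx1, hl x (by linarith)]
  rw [glue_of_lt _ _ hx1]
  rcases le_or_gt x (T + 1 / 2) with hx2 | hx2
  · rw [glue_of_le _ _ hx2, hx ⟨by linarith, by linarith⟩]
  · rw [glue_of_lt _ _ hx2, hr x (by linarith)]

theorem optimalProfile_le_of_isH2 {W : ℝ → ℝ} (hW : IsDoubleWell W) (k : ℝ) {U V w : ℝ → ℝ}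
    (h : IsH2 U V w) {s t : ℝ} (hst : s ≤ t) (hU : U s = -1) (hV : V s = 0) (hU' : U t = 1)
    (hV' : V t = 0) : optimalProfile W k ≤ (scaledEnergy W k 1 U V w s t : ℝ) := by
  refine ((IsProfile.of_isH2 h hst hU hV hU' hV').optimalProfile_le hW k).trans_eq ?_
  congr 1
  refine intervalIntegral.integral_congr_ae (ae_of_all _ fun x hx => ?_)
  rw [uIoc_of_le hst] at hx
  simp only [glue_of_lt _ _ hx.1, glue_of_le _ _ hx.2]

theorem optimalProfile_lt_top {W : ℝ → ℝ} (hW : IsDoubleWell W) (k : ℝ) :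
    optimalProfile W k < ⊤ := by
  -- The odd cubic that takes the values `±1` at `±1` with zero slope.
  have h : IsH2 (fun x => (3 * x - x ^ 3) / 2) (fun x => (3 - 3 * x ^ 2) / 2) (fun x => -3 * x) := by
    refine IsH2.of_contDiff (fun x => ?_) (fun x => ?_) (by fun_prop)
    · exact ((((hasDerivAt_id x).const_mul 3).sub (hasDerivAt_pow 3 x)).div_const 2).congr_deriv
        (by norm_num)
    · exact ((((hasDerivAt_pow 2 x).const_mul 3).const_sub 3).div_const 2).congr_deriv
        (by norm_num; ring)
  exact (optimalProfile_le_of_isH2 hW k h (s := -1) (t := 1) (by norm_num) (by norm_num)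
    (by norm_num) (by norm_num) (by norm_num)).trans_lt (EReal.coe_lt_top _)

/-- The energy of a transition between the wells is bounded from below. -/
theorem transition_lower_bound {W : ℝ → ℝ} (hW : IsDoubleWell W) {c : ℝ} (hc : 0 < c)
    (hc1 : ∀ s, 0 ≤ s → c * (s - 1) ^ 2 ≤ W s) {U V w : ℝ → ℝ} (h : IsH2 U V w) {s t : ℝ}
    (hst : s ≤ t) (hU : U s ≤ 0) (hU' : 1 / 2 ≤ U t) :
    min c 1 / 4 ≤ scaledEnergy W (-1) 1 U V w s t := by
  have hUc := h.fst.continuous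
  -- `q` is the first point with `U ≥ 1/2`, and `p` below the last one before it with `U ≤ 0`. In
  -- between `0 < U < 1/2`, at distance at least `1/2` from the well `1`.
  obtain ⟨q, hq⟩ := (isCompact_Icc.inter_right
    (isClosed_le (continuous_const (y := (1 / 2 : ℝ))) hUc)).exists_isLeast
    (s := Icc s t ∩ {x | 1 / 2 ≤ U x}) ⟨t, ⟨hst, le_rfl⟩, hU'⟩
  have hsq : s ≤ q := hq.1.1.1
  have hqU : 1 / 2 ≤ U q := hq.1.2
  obtain ⟨p, hp⟩ := (isCompact_Icc.inter_right
    (isClosed_le hUc (continuous_const (y := (0 : ℝ))))).exists_isGreatest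
    (s := Icc s q ∩ {x | U x ≤ 0}) ⟨s, ⟨le_rfl, hsq⟩, hU⟩
  have hpU : U p ≤ 0 := hp.1.2
  have hpq : p < q := lt_of_le_of_ne hp.1.1.2 fun e => by rw [e] at hpU; linarith
  set d := q - p with hd
  have hd0 : 0 < d := sub_pos.2 hpq
  have hmid : ∀ x ∈ Ioo p q, c / 4 ≤ W (U x) := by
    intro x hx
    have h1 : 0 < U x := by
      by_contra hn
      exact absurd (hp.2 ⟨⟨hp.1.1.1.trans hx.1.le, hx.2.le⟩, not_lt.1 hn⟩) (not_le.2 hx.1)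
    have h2 : U x < 1 / 2 := by
      by_contra hn
      exact absurd (hq.2 ⟨⟨hp.1.1.1.trans hx.1.le, hx.2.le.trans hq.1.1.2⟩, not_lt.1 hn⟩)
        (not_le.2 hx.2)
    refine le_trans ?_ (hc1 _ h1.le)
    have : 1 / 4 ≤ (U x - 1) ^ 2 := by nlinarith
    nlinarith
  have iW : ∀ x y, IntervalIntegrable (fun t => W (U t)) volume x y := fun x y =>
    (hW.continuous.comp hUc).intervalIntegrable x y
  have e1 : d * (c / 4) ≤ ∫ x in p..q, W (U x) := by
    have := intervalIntegral.integral_mono_on_of_le_Ioo hpq.le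
      (intervalIntegrable_const (c := c / 4)) (iW p q) hmid
    rwa [intervalIntegral.integral_const, smul_eq_mul] at this
  have e2 : 1 / 4 ≤ d * ∫ x in p..q, V x ^ 2 := by
    refine le_trans ?_ (h.sq_sub_fst_le hpq.le)
    nlinarith
  have e3 : ∫ x in p..q, W (U x) ≤ ∫ x in s..t, W (U x) :=
    intervalIntegral.integral_mono_interval hp.1.1.1 hpq.le hq.1.1.2
      (ae_of_all _ fun x => hW.nonneg _) (iW s t)
  have e4 : ∫ x in p..q, V x ^ 2 ≤ ∫ x in s..t, V x ^ 2 :=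
    intervalIntegral.integral_mono_interval hp.1.1.1 hpq.le hq.1.1.2
      (ae_of_all _ fun x => sq_nonneg _) ((h.snd.continuous.pow 2).intervalIntegrable s t)
  have e5 : 0 ≤ ∫ x in s..t, w x ^ 2 :=
    intervalIntegral.integral_nonneg hst fun t _ => sq_nonneg _
  have e6 : 0 ≤ ∫ x in p..q, V x ^ 2 :=
    intervalIntegral.integral_nonneg hpq.le fun t _ => sq_nonneg _
  rw [scaledEnergy_one hW.continuous h]
  -- A slow passage pays `d · c/4` through `W`; a fast one pays `1 / (4 d)` through the slope.
  rcases le_total 1 d with h1 | h1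
  · have : c / 4 ≤ d * (c / 4) := le_mul_of_one_le_left (by positivity) h1
    have := min_le_left c 1
    linarith
  · have : d * ∫ x in p..q, V x ^ 2 ≤ ∫ x in p..q, V x ^ 2 := mul_le_of_le_one_left e6 h1
    have := min_le_right c 1
    have : 0 ≤ d * (c / 4) := by positivity
    linarith

theorem exists_pos_le_optimalProfile {W : ℝ → ℝ} (hW : IsDoubleWell W) {k₀ k : ℝ}
    (hk₀ : 0 < k₀) (hk : IsInterpolationConstant W k₀) (hkk : k < k₀) :
    ∃ μ : ℝ, 0 < μ ∧ (μ : EReal) ≤ optimalProfile W k := by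
  obtain ⟨c, hc, hc1, -⟩ := hW.growth
  obtain ⟨η, L, hη, hL, H⟩ := hW.exists_coercive hk₀ hk hkk
  refine ⟨η * (min c 1 / 4), by positivity, le_iInf₂ fun f hf => ?_⟩
  obtain ⟨U, V, w, s, t, hp, hfU⟩ := exists_isProfile hf
  -- Widening the interval to length at least `L` makes coercivity applicable and is free, since the
  -- profile rests at the wells there.
  have hp' := hp.mono (s' := s - L) (t' := t + 1) (by linarith) (by linarith)
  rw [hp'.integral_eq hW k hfU, EReal.coe_le_coe_iff]
  refine le_trans ?_ (H U V w hp.isH2 1 _ _ one_pos (by linarith [hp.le]))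
  refine mul_le_mul_of_nonneg_left ?_ hη.le
  refine transition_lower_bound hW hc hc1 hp.isH2 hp'.le ?_ ?_
  · rw [(hp.left (s - L) (by linarith)).1]; norm_num
  · rw [(hp.right (t + 1) (by linarith)).1]; norm_num

/-! ### Completing an approximate transition to a profile. -/

theorem isH2_cubic (σ p q : ℝ) : IsH2 (fun x => σ + p * x ^ 2 + q * x ^ 3)
    (fun x => 2 * p * x + 3 * q * x ^ 2) (fun x => 2 * p + 6 * q * x) := by
  refine IsH2.of_contDiff (fun x => ?_) (fun x => ?_) (by fun_prop)
  · exact ((((hasDerivAt_pow 2 x).const_mul p).const_add σ).add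
      ((hasDerivAt_pow 3 x).const_mul q)).congr_deriv (by norm_num; ring)
  · exact (((hasDerivAt_id x).const_mul (2 * p)).add
      ((hasDerivAt_pow 2 x).const_mul (3 * q))).congr_deriv (by norm_num; ring)

/-- The cubic is the Hermite interpolant on `[0, 1]` from value `σ` and slope `0` to value `σ + α`
and slope `v`. Its energy is continuous in `(α, v)` and zero at the origin. -/
theorem exists_cubic_cost_le {W : ℝ → ℝ} (hW : IsDoubleWell W) (k : ℝ) {σ : ℝ}
    (hσ : σ = 1 ∨ σ = -1) {δ : ℝ} (hδ : 0 < δ) : ∃ γ : ℝ, 0 < γ ∧ ∀ α v : ℝ, |α| < γ → |v| < γ →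
      scaledEnergy W k 1 (fun x => σ + (3 * α - v) * x ^ 2 + (v - 2 * α) * x ^ 3)
        (fun x => 2 * (3 * α - v) * x + 3 * (v - 2 * α) * x ^ 2)
        (fun x => 2 * (3 * α - v) + 6 * (v - 2 * α) * x) 0 1 < δ := by
  have hWc := hW.continuous
  have hcont : Continuous fun z : ℝ × ℝ => scaledEnergy W k 1
      (fun x => σ + (3 * z.1 - z.2) * x ^ 2 + (z.2 - 2 * z.1) * x ^ 3)
      (fun x => 2 * (3 * z.1 - z.2) * x + 3 * (z.2 - 2 * z.1) * x ^ 2)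
      (fun x => 2 * (3 * z.1 - z.2) + 6 * (z.2 - 2 * z.1) * x) 0 1 := by
    unfold scaledEnergy
    refine intervalIntegral.continuous_parametric_intervalIntegral_of_continuous' ?_ 0 1
    simp only [Function.uncurry_def]
    fun_prop
  have h0 : scaledEnergy W k 1
      (fun x => σ + (3 * (0 : ℝ × ℝ).1 - (0 : ℝ × ℝ).2) * x ^ 2 +
        ((0 : ℝ × ℝ).2 - 2 * (0 : ℝ × ℝ).1) * x ^ 3)
      (fun x => 2 * (3 * (0 : ℝ × ℝ).1 - (0 : ℝ × ℝ).2) * x +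
        3 * ((0 : ℝ × ℝ).2 - 2 * (0 : ℝ × ℝ).1) * x ^ 2)
      (fun x => 2 * (3 * (0 : ℝ × ℝ).1 - (0 : ℝ × ℝ).2) +
        6 * ((0 : ℝ × ℝ).2 - 2 * (0 : ℝ × ℝ).1) * x) 0 1 = 0 := by
    simp [scaledEnergy, (hW.eq_zero_iff σ).2 hσ]
  have hev := (hcont.tendsto (0 : ℝ × ℝ)).eventually (gt_mem_nhds (h0.trans_lt hδ))
  obtain ⟨γ, hγ, H⟩ := Metric.eventually_nhds_iff.1 hev
  refine ⟨γ, hγ, fun α v hα hv => @H (α, v) ?_⟩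
  rw [Prod.dist_eq]
  simpa using ⟨hα, hv⟩

/-- Cubics on `[s - 1, s]` and `[t, t + 1]` lead from the wells to the end data of `U`. The result
is a competitor, and each cubic costs less than `δ / 2`. -/
theorem exists_transition_one {W : ℝ → ℝ} (hW : IsDoubleWell W) {k m : ℝ}
    (hm : (m : EReal) ≤ optimalProfile W k) {δ : ℝ} (hδ : 0 < δ) :
    ∃ γ : ℝ, 0 < γ ∧ ∀ U V w : ℝ → ℝ, IsH2 U V w → ∀ s t : ℝ, s ≤ t →
      |U s + 1| < γ → |V s| < γ → |U t - 1| < γ → |V t| < γ →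
      m ≤ scaledEnergy W k 1 U V w s t + δ := by
  obtain ⟨γ₁, hγ₁, H₁⟩ := exists_cubic_cost_le hW k (σ := -1) (Or.inr rfl) (half_pos hδ)
  obtain ⟨γ₂, hγ₂, H₂⟩ := exists_cubic_cost_le hW k (σ := 1) (Or.inl rfl) (half_pos hδ)
  refine ⟨min γ₁ γ₂, lt_min hγ₁ hγ₂, fun U V w h s t hst hUs hVs hUt hVt => ?_⟩
  have c₁ := H₁ (U s + 1) (V s) (hUs.trans_le (min_le_left _ _)) (hVs.trans_le (min_le_left _ _))
  -- The right-hand cubic is run backwards, so it must arrive with the opposite slope.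
  have c₂ := H₂ (U t - 1) (-V t) (hUt.trans_le (min_le_right _ _))
    (by rw [abs_neg]; exact hVt.trans_le (min_le_right _ _))
  set α₁ := U s + 1 with hα₁
  set α₂ := U t - 1 with hα₂
  have hP := (isH2_cubic (-1) (3 * α₁ - V s) (V s - 2 * α₁)).affine one_ne_zero (-(s - 1))
  have hQ := (isH2_cubic 1 (3 * α₂ - -V t) (-V t - 2 * α₂)).affine
    (show (-1 : ℝ) ≠ 0 by norm_num) (t + 1)
  rw [← sub_self (s - 1)] at c₁
  have eP := scaledEnergy_affine W k (ε := 1) one_pos (-(s - 1))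
    (fun x => -1 + (3 * α₁ - V s) * x ^ 2 + (V s - 2 * α₁) * x ^ 3)
    (fun x => 2 * (3 * α₁ - V s) * x + 3 * (V s - 2 * α₁) * x ^ 2)
    (fun x => 2 * (3 * α₁ - V s) + 6 * (V s - 2 * α₁) * x) (s - 1) s
  rw [show (1 : ℝ) * (s - 1) + -(s - 1) = s - 1 - (s - 1) by ring,
    show (1 : ℝ) * s + -(s - 1) = 1 by ring, mul_one] at eP
  rw [← eP] at c₁
  have eQ := scaledEnergy_neg W k 1 (t + 1)
    (fun x => 1 + (3 * α₂ - -V t) * x ^ 2 + (-V t - 2 * α₂) * x ^ 3)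
    (fun x => 2 * (3 * α₂ - -V t) * x + 3 * (-V t - 2 * α₂) * x ^ 2)
    (fun x => 2 * (3 * α₂ - -V t) + 6 * (-V t - 2 * α₂) * x) t (t + 1)
  rw [show t + 1 - (t + 1) = 0 by ring, show t + 1 - t = 1 by ring] at eQ
  rw [← eQ] at c₂
  have jU : U t = 1 + (3 * α₂ - -V t) * (-1 * t + (t + 1)) ^ 2 +
      (-V t - 2 * α₂) * (-1 * t + (t + 1)) ^ 3 := by
    rw [show -1 * t + (t + 1) = 1 by ring, hα₂]; ring
  have jV : V t = -1 * (2 * (3 * α₂ - -V t) * (-1 * t + (t + 1)) +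
      3 * (-V t - 2 * α₂) * (-1 * t + (t + 1)) ^ 2) := by
    rw [show -1 * t + (t + 1) = 1 by ring]; ring
  have jU' : -1 + (3 * α₁ - V s) * (1 * s + -(s - 1)) ^ 2 +
      (V s - 2 * α₁) * (1 * s + -(s - 1)) ^ 3 = U s := by
    rw [show 1 * s + -(s - 1) = 1 by ring, hα₁]; ring
  have jV' : 1 * (2 * (3 * α₁ - V s) * (1 * s + -(s - 1)) +
      3 * (V s - 2 * α₁) * (1 * s + -(s - 1)) ^ 2) = V s := by
    rw [show 1 * s + -(s - 1) = 1 by ring]; ring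
  have hR := h.glue hQ jU jV
  have kU := jU'.trans (glue_of_le U (fun x => 1 + (3 * α₂ - -V t) * (-1 * x + (t + 1)) ^ 2 +
      (-V t - 2 * α₂) * (-1 * x + (t + 1)) ^ 3) hst).symm
  have kV := jV'.trans (glue_of_le V (fun x => -1 * (2 * (3 * α₂ - -V t) * (-1 * x + (t + 1)) +
      3 * (-V t - 2 * α₂) * (-1 * x + (t + 1)) ^ 2)) hst).symm
  have hG := hP.glue hR kU kV
  have hopt := optimalProfile_le_of_isH2 hW k hG (s := s - 1) (t := t + 1) (by linarith)
    (by rw [glue_of_le _ _ (by linarith)]; ring) (by rw [glue_of_le _ _ (by linarith)]; ring)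
    (by rw [glue_of_lt _ _ (by linarith), glue_of_lt _ _ (by linarith)]; ring)
    (by rw [glue_of_lt _ _ (by linarith), glue_of_lt _ _ (by linarith)]; ring)
  rw [scaledEnergy_glue k 1 (by linarith) (by linarith) hW.continuous hP hR kU kV,
    scaledEnergy_glue k 1 hst (by linarith) hW.continuous h hQ jU jV] at hopt
  exact (EReal.coe_le_coe_iff.1 (hm.trans hopt)).trans
    ((add_le_add c₁.le (add_le_add le_rfl c₂.le)).trans_eq (by ring))

/-- The energy of a transition between the wells, in either direction, that starts and ends with
almost vanishing slope is almost at least the optimal-profile constant. -/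
theorem exists_transition {W : ℝ → ℝ} (hW : IsDoubleWell W) {k m : ℝ}
    (hm : (m : EReal) ≤ optimalProfile W k) {δ : ℝ} (hδ : 0 < δ) :
    ∃ γ : ℝ, 0 < γ ∧ ∀ U V w : ℝ → ℝ, IsH2 U V w → ∀ σ ε s t : ℝ, (σ = 1 ∨ σ = -1) → 0 < ε →
      s ≤ t → |U s - σ| < γ → |ε * V s| < γ → |U t + σ| < γ → |ε * V t| < γ →
      m ≤ scaledEnergy W k ε U V w s t + δ := by
  obtain ⟨γ, hγ, H⟩ := exists_transition_one hW hm hδ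
  refine ⟨γ, hγ, fun U V w h σ ε s t hσ hε hst h1 h2 h3 h4 => ?_⟩
  have hs : ε * (s / ε) + 0 = s := by rw [add_zero, mul_div_cancel₀ _ hε.ne']
  have ht : ε * (t / ε) + 0 = t := by rw [add_zero, mul_div_cancel₀ _ hε.ne']
  have hE := h.affine hε.ne' 0
  have eE := scaledEnergy_affine W k (ε := 1) hε 0 U V w (s / ε) (t / ε)
  rw [hs, ht, one_mul] at eE
  have hst' : s / ε ≤ t / ε := by gcongr
  rw [← eE]
  rcases hσ with rfl | rfl
  -- A descent from `1` to `-1` becomes an ascent under reflection, which leaves the energy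
  -- unchanged and swaps the end points.
  · have hR := hE.affine (show (-1 : ℝ) ≠ 0 by norm_num) 0
    have eR := scaledEnergy_neg W k 1 0 (fun x => U (ε * x + 0)) (fun x => ε * V (ε * x + 0))
      (fun x => ε ^ 2 * w (ε * x + 0)) (-(t / ε)) (-(s / ε))
    rw [show 0 - -(s / ε) = s / ε by ring, show 0 - -(t / ε) = t / ε by ring] at eR
    rw [← eR]
    have es : -1 * -(s / ε) + 0 = s / ε := by ring
    have et : -1 * -(t / ε) + 0 = t / ε := by ring
    refine H _ _ _ hR _ _ (by linarith) ?_ ?_ ?_ ?_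
    · rwa [et, ht]
    · rwa [et, ht, neg_one_mul, abs_neg]
    · rwa [es, hs]
    · rwa [es, hs, neg_one_mul, abs_neg]
  · refine H _ _ _ hE _ _ hst' ?_ ?_ ?_ ?_
    · rwa [hs, ← sub_neg_eq_add]
    · rwa [hs]
    · rwa [ht]
    · rwa [ht]

/-! ### Essential jumps. -/

/-- The points of `(a, b)` near which `u` is almost everywhere equal neither to `1` nor
to `-1`. -/
def essJump (a b : ℝ) (u : ℝ → ℝ) : Set ℝ :=
  {x ∈ Ioo a b | ∀ r > 0, ∀ σ : ℝ, σ = 1 ∨ σ = -1 →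
    ¬ ∀ᵐ y ∂volume.restrict (Ioo (x - r) (x + r)), u y = σ}

theorem notMem_essJump {a b : ℝ} {u : ℝ → ℝ} {x : ℝ} (hx : x ∈ Ioo a b) (h : x ∉ essJump a b u) :
    ∃ r > 0, ∃ σ : ℝ, (σ = 1 ∨ σ = -1) ∧
      ∀ᵐ y ∂volume.restrict (Ioo (x - r) (x + r)), u y = σ := by
  by_contra hn
  refine h ⟨hx, fun r hr σ hσ hu => hn ⟨r, hr, σ, hσ, hu⟩⟩

theorem essJump_congr {a b : ℝ} {u v : ℝ → ℝ} (huv : u =ᵐ[volume.restrict (Ioo a b)] v) :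
    essJump a b u ⊆ essJump a b v := by
  intro x hx
  by_contra hn
  obtain ⟨r, hr, σ, hσ, h⟩ := notMem_essJump hx.1 hn
  have hxa := hx.1.1
  have hxb := hx.1.2
  have hr' : 0 < min r (min (x - a) (b - x)) :=
    lt_min hr (lt_min (by linarith) (by linarith))
  refine hx.2 _ hr' σ hσ ?_
  set ρ := min r (min (x - a) (b - x)) with hρ
  have h1 : ρ ≤ r := min_le_left _ _
  have h2 : ρ ≤ x - a := (min_le_right _ _).trans (min_le_left _ _)
  have h3 : ρ ≤ b - x := (min_le_right _ _).trans (min_le_right _ _)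
  have e1 := ae_restrict_of_ae_restrict_of_subset
    (Ioo_subset_Ioo (by linarith) (by linarith) : Ioo (x - ρ) (x + ρ) ⊆ Ioo (x - r) (x + r)) h
  have e2 := ae_restrict_of_ae_restrict_of_subset
    (Ioo_subset_Ioo (by linarith) (by linarith) : Ioo (x - ρ) (x + ρ) ⊆ Ioo a b) huv
  filter_upwards [e1, e2] with y h1 h2
  rw [h2, h1]

/-- If the value `σ` were missed on a neighbourhood within a set of full measure, `u` would be
almost everywhere `-σ` there. The set `E` will carry the pointwise convergence. -/
theorem exists_mem_of_mem_essJump {a b : ℝ} {u : ℝ → ℝ} {x : ℝ} (hx : x ∈ essJump a b u)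
    {α β : ℝ} (hα : α < x) (hβ : x < β) {E : Set ℝ}
    (hE : ∀ᵐ y ∂volume.restrict (Ioo a b), y ∈ E ∧ (u y = 1 ∨ u y = -1)) {σ : ℝ}
    (hσ : σ = 1 ∨ σ = -1) : ∃ p ∈ Ioo α β ∩ Ioo a b, p ∈ E ∧ u p = σ := by
  by_contra hn
  have hxa := hx.1.1
  have hxb := hx.1.2
  set ρ := min (min (x - α) (β - x)) (min (x - a) (b - x)) with hρ
  have hr' : 0 < ρ := lt_min (lt_min (by linarith) (by linarith))
    (lt_min (by linarith) (by linarith))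
  have h1 : ρ ≤ x - α := (min_le_left _ _).trans (min_le_left _ _)
  have h2 : ρ ≤ β - x := (min_le_left _ _).trans (min_le_right _ _)
  have h3 : ρ ≤ x - a := (min_le_right _ _).trans (min_le_left _ _)
  have h4 : ρ ≤ b - x := (min_le_right _ _).trans (min_le_right _ _)
  refine hx.2 ρ hr' (-σ) (by rcases hσ with rfl | rfl <;> simp) ?_
  filter_upwards [ae_restrict_of_ae_restrict_of_subset
    (Ioo_subset_Ioo (by linarith) (by linarith) : Ioo (x - ρ) (x + ρ) ⊆ Ioo a b) hE,
    ae_restrict_mem measurableSet_Ioo] with y hy hm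
  have h5 : u y ≠ σ := fun h => hn ⟨y, ⟨⟨by linarith [hm.1], by linarith [hm.2]⟩,
    ⟨by linarith [hm.1], by linarith [hm.2]⟩⟩, hy.1, h⟩
  rcases hσ with rfl | rfl <;> rcases hy.2 with h | h
  · exact absurd h h5
  · exact h
  · rw [h, neg_neg]
  · exact absurd h h5

theorem isOpen_setOf_locally_eq (u : ℝ → ℝ) (σ : ℝ) :
    IsOpen {x | ∃ r > 0, ∀ᵐ y ∂volume.restrict (Ioo (x - r) (x + r)), u y = σ} := by
  rw [Metric.isOpen_iff]
  rintro x ⟨r, hr, h⟩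
  refine ⟨r / 2, by positivity, fun y hy => ⟨r / 2, by positivity, ?_⟩⟩
  rw [Metric.mem_ball, Real.dist_eq, abs_lt] at hy
  exact ae_restrict_of_ae_restrict_of_subset
    (Ioo_subset_Ioo (by linarith [hy.1]) (by linarith [hy.2])) h

/-- The sets where `u` is locally `1` and locally `-1` are open and disjoint and cover the interval,
which is connected. -/
theorem exists_ae_eq_of_disjoint_essJump {a b α β : ℝ} {u : ℝ → ℝ} (hαβ : α < β)
    (hsub : Ioo α β ⊆ Ioo a b) (hd : ∀ x ∈ Ioo α β, x ∉ essJump a b u) :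
    ∃ σ : ℝ, (σ = 1 ∨ σ = -1) ∧ ∀ᵐ y ∂volume.restrict (Ioo α β), u y = σ := by
  set A : ℝ → Set ℝ :=
    fun σ => {x | ∃ r > 0, ∀ᵐ y ∂volume.restrict (Ioo (x - r) (x + r)), u y = σ} with hA
  have hcov : Ioo α β ⊆ A 1 ∪ A (-1) := by
    intro x hx
    obtain ⟨r, hr, σ, rfl | rfl, h⟩ := notMem_essJump (hsub hx) (hd x hx)
    · exact Or.inl ⟨r, hr, h⟩
    · exact Or.inr ⟨r, hr, h⟩
  have hdis : Disjoint (A 1) (A (-1)) := by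
    rw [Set.disjoint_left]
    rintro x ⟨r, hr, h⟩ ⟨r', hr', h'⟩
    have hm : 0 < min r r' := lt_min hr hr'
    have e1 := ae_restrict_of_ae_restrict_of_subset (Ioo_subset_Ioo
      (by linarith [min_le_left r r']) (by linarith [min_le_left r r']) :
        Ioo (x - min r r') (x + min r r') ⊆ Ioo (x - r) (x + r)) h
    have e2 := ae_restrict_of_ae_restrict_of_subset (Ioo_subset_Ioo
      (by linarith [min_le_right r r']) (by linarith [min_le_right r r']) :
        Ioo (x - min r r') (x + min r r') ⊆ Ioo (x - r') (x + r')) h'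
    have : ∀ᵐ y ∂volume.restrict (Ioo (x - min r r') (x + min r r')), False := by
      filter_upwards [e1, e2] with y h1 h2
      rw [h1] at h2
      norm_num at h2
    rw [eventually_false_iff_eq_bot, ae_eq_bot, Measure.restrict_eq_zero, Real.volume_Ioo,
      ENNReal.ofReal_eq_zero] at this
    linarith
  have fin : ∀ σ, Ioo α β ⊆ A σ → ∀ᵐ y ∂volume.restrict (Ioo α β), u y = σ := by
    intro σ hs
    rw [ae_restrict_iff' measurableSet_Ioo, ae_iff]
    refine measure_null_of_locally_null _ fun x hx => ?_
    simp only [mem_ofPred_eq, Classical.not_imp] at hx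
    obtain ⟨r, hr, h⟩ := hs hx.1
    rw [ae_restrict_iff' measurableSet_Ioo, ae_iff] at h
    refine ⟨Ioo (x - r) (x + r) ∩ {y | u y ≠ σ}, ?_, ?_⟩
    · have h1 : Ioo (x - r) (x + r) ∈ 𝓝 x := Ioo_mem_nhds (by linarith) (by linarith)
      filter_upwards [mem_nhdsWithin_of_mem_nhds h1, self_mem_nhdsWithin] with y h2 h3
      simp only [Classical.not_imp] at h3
      exact ⟨h2, h3.2⟩
    · convert h using 2
      ext y
      simp [and_assoc]
  have o1 : IsOpen (A 1) := isOpen_setOf_locally_eq u 1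
  have o2 : IsOpen (A (-1)) := isOpen_setOf_locally_eq u (-1)
  have hmid : (α + β) / 2 ∈ Ioo α β := ⟨by linarith, by linarith⟩
  rcases hcov hmid with h | h
  · exact ⟨1, Or.inl rfl, fin 1
      (isPreconnected_Ioo.subset_left_of_subset_union o1 o2 hdis hcov ⟨_, hmid, h⟩)⟩
  · exact ⟨-1, Or.inr rfl, fin (-1)
      (isPreconnected_Ioo.subset_left_of_subset_union o2 o1 hdis.symm
        (by rwa [union_comm]) ⟨_, hmid, h⟩)⟩

/-! ### Step functions, the jump set and bounded variation. -/

/-- The piecewise constant function that changes sign at the points of `F` and is equal to `σ` to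
the right of them. -/
def step (σ : ℝ) (F : Finset ℝ) (x : ℝ) : ℝ := σ * ∏ s ∈ F, if s < x then 1 else -1

theorem step_empty (σ x : ℝ) : step σ ∅ x = σ := by simp [step]

theorem step_insert (σ : ℝ) {F : Finset ℝ} {s : ℝ} (hs : s ∉ F) (x : ℝ) :
    step σ (insert s F) x = (if s < x then 1 else -1) * step σ F x := by
  rw [step, Finset.prod_insert hs, step]
  ring

theorem step_eq_or (σ : ℝ) (hσ : σ = 1 ∨ σ = -1) (F : Finset ℝ) (x : ℝ) :
    step σ F x = 1 ∨ step σ F x = -1 := by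
  classical
  induction F using Finset.induction_on with
  | empty => simpa [step] using hσ
  | insert s F hs ih =>
    rw [step_insert _ hs]
    split_ifs
    · simpa using ih
    · rcases ih with ih | ih <;> simp [ih]

theorem step_neg (σ : ℝ) (F : Finset ℝ) (x : ℝ) : step (-σ) F x = -step σ F x := by
  simp [step]

theorem step_of_forall_lt (σ : ℝ) {F : Finset ℝ} {x : ℝ} (h : ∀ s ∈ F, s < x) :
    step σ F x = σ := by
  rw [step, Finset.prod_eq_one fun s hs => if_pos (h s hs), mul_one]

theorem step_eq_of_disjoint (σ : ℝ) {F : Finset ℝ} {l u : ℝ} (h : ∀ s ∈ F, s ∉ Ioo l u) {x y : ℝ}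
    (hx : x ∈ Ioo l u) (hy : y ∈ Ioo l u) : step σ F x = step σ F y := by
  rw [step, step]
  congr 1
  refine Finset.prod_congr rfl fun s hs => ?_
  have : s < x ↔ s < y := by
    have h1 := h s hs
    rw [mem_Ioo, not_and_or, not_lt, not_lt] at h1
    rcases h1 with h1 | h1
    · exact ⟨fun _ => h1.trans_lt hy.1, fun _ => h1.trans_lt hx.1⟩
    · exact ⟨fun h2 => absurd (h2.trans hx.2) (not_lt.2 h1),
        fun h2 => absurd (h2.trans hy.2) (not_lt.2 h1)⟩
  simp only [this]

theorem measurable_step (σ : ℝ) (F : Finset ℝ) : Measurable (step σ F) := by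
  unfold step
  refine measurable_const.mul (Finset.measurable_fun_prod _ fun s _ => ?_)
  exact Measurable.ite measurableSet_Ioi measurable_const measurable_const

theorem boundedVariationOn_step (σ : ℝ) (F : Finset ℝ) (S : Set ℝ) :
    BoundedVariationOn (step σ F) S := by
  classical
  induction F using Finset.induction_on with
  | empty =>
    have : step σ ∅ = fun _ => σ := funext fun x => step_empty σ x
    rw [this]
    exact MonotoneOn.boundedVariationOn (C := |σ|) (fun _ _ _ _ _ => le_rfl) fun _ _ => le_rfl
  | insert s F hs ih =>
    have : step σ (insert s F) = (fun x => if s < x then (1 : ℝ) else -1) * step σ F :=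
      funext fun x => step_insert σ hs x
    rw [this]
    refine BoundedVariationOn.mul (MonotoneOn.boundedVariationOn (C := 1) ?_ ?_) ih
    · intro x _ y _ hxy
      dsimp only
      split_ifs with h1 h2
      · exact le_rfl
      · exact absurd (h1.trans_le hxy) h2
      · norm_num
      · exact le_rfl
    · intro x _
      split_ifs <;> simp

theorem exists_radius (F : Finset ℝ) {a b x : ℝ} (hx : x ∈ Ioo a b) :
    ∃ r > 0, Ioo (x - r) (x + r) ⊆ Ioo a b ∧ ∀ s ∈ F.erase x, s ∉ Ioo (x - r) (x + r) := by
  have h : (Ioo a b ∩ (↑(F.erase x) : Set ℝ)ᶜ) ∈ 𝓝 x :=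
    inter_mem (isOpen_Ioo.mem_nhds hx)
      ((F.erase x).finite_toSet.isClosed.isOpen_compl.mem_nhds (by simp))
  obtain ⟨r, hr, hsub⟩ := Metric.mem_nhds_iff.1 h
  rw [Real.ball_eq_Ioo] at hsub
  exact ⟨r, hr, hsub.trans inter_subset_left, fun s hs hm => (hsub hm).2 hs⟩

/-- At an isolated essential jump point the function changes its sign. -/
theorem exists_sign_change {a b : ℝ} {u : ℝ → ℝ} {F : Finset ℝ} (hF : (F : Set ℝ) = essJump a b u)
    {x : ℝ} (hx : x ∈ F) : ∃ r > 0, Ioo (x - r) (x + r) ⊆ Ioo a b ∧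
      (∀ s ∈ F.erase x, s ∉ Ioo (x - r) (x + r)) ∧ ∃ τ : ℝ, (τ = 1 ∨ τ = -1) ∧
      (∀ᵐ y ∂volume.restrict (Ioo (x - r) x), u y = -τ) ∧
      ∀ᵐ y ∂volume.restrict (Ioo x (x + r)), u y = τ := by
  have hxe : x ∈ essJump a b u := hF ▸ (Finset.mem_coe.2 hx)
  obtain ⟨r, hr, hsub, hd⟩ := exists_radius F hxe.1
  refine ⟨r, hr, hsub, hd, ?_⟩
  have hl : ∀ y ∈ Ioo (x - r) x, y ∉ essJump a b u := by
    intro y hy hm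
    rw [← hF, Finset.mem_coe] at hm
    exact hd y (Finset.mem_erase.2 ⟨hy.2.ne, hm⟩) ⟨hy.1, by linarith [hy.2]⟩
  have hr' : ∀ y ∈ Ioo x (x + r), y ∉ essJump a b u := by
    intro y hy hm
    rw [← hF, Finset.mem_coe] at hm
    exact hd y (Finset.mem_erase.2 ⟨hy.1.ne', hm⟩) ⟨by linarith [hy.1], hy.2⟩
  obtain ⟨σ, hσ, h1⟩ := exists_ae_eq_of_disjoint_essJump (by linarith)
    ((Ioo_subset_Ioo le_rfl (by linarith)).trans hsub) hl
  obtain ⟨τ, hτ, h2⟩ := exists_ae_eq_of_disjoint_essJump (by linarith)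
    ((Ioo_subset_Ioo (by linarith) le_rfl).trans hsub) hr'
  have hne : σ ≠ τ := by
    rintro rfl
    refine hxe.2 r hr σ hσ ?_
    rw [ae_restrict_iff' measurableSet_Ioo] at h1 h2 ⊢
    filter_upwards [h1, h2, Measure.ae_ne volume x] with y e1 e2 e3 hy
    rcases lt_or_gt_of_ne e3 with h | h
    · exact e1 ⟨hy.1, h⟩
    · exact e2 ⟨h, hy.2⟩
  refine ⟨τ, hτ, ?_, h2⟩
  have : σ = -τ := by
    rcases hσ with rfl | rfl <;> rcases hτ with rfl | rfl <;> simp_all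
  rwa [← this]

/-- `u` and `step 1 F` change sign at the same points, so their product has no essential jump and is
almost everywhere a constant sign `σ`. -/
theorem exists_ae_eq_step {a b : ℝ} (hab : a < b) {u : ℝ → ℝ} {F : Finset ℝ}
    (hF : (F : Set ℝ) = essJump a b u) :
    ∃ σ : ℝ, (σ = 1 ∨ σ = -1) ∧ u =ᵐ[volume.restrict (Ioo a b)] step σ F := by
  have key : ∀ x ∈ Ioo a b, x ∉ essJump a b fun y => u y * step 1 F y := by
    intro x hx hn
    have hsq : ∀ y z, step 1 F y = step 1 F z → step 1 F y * step 1 F z = 1 := by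
      intro y z h
      rw [h]
      rcases step_eq_or 1 (Or.inl rfl) F z with h | h <;> rw [h] <;> norm_num
    by_cases hxF : x ∈ F
    · obtain ⟨r, hr, hsub, hd, τ, hτ, h1, h2⟩ := exists_sign_change hF hxF
      have hst := step_eq_or 1 (Or.inl rfl) (F.erase x) x
      refine hn.2 r hr (τ * step 1 (F.erase x) x) ?_ ?_
      · rcases hτ with rfl | rfl <;> rcases hst with h | h <;> simp [h]
      rw [ae_restrict_iff' measurableSet_Ioo] at h1 h2 ⊢
      filter_upwards [h1, h2, Measure.ae_ne volume x] with y e1 e2 e3 hy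
      have e4 : step 1 F y = (if x < y then 1 else -1) * step 1 (F.erase x) y := by
        rw [← step_insert 1 (Finset.notMem_erase x F), Finset.insert_erase hxF]
      have e5 := step_eq_of_disjoint 1 hd hy (show x ∈ Ioo (x - r) (x + r) from
        ⟨by linarith, by linarith⟩)
      rw [e4, e5]
      rcases lt_or_gt_of_ne e3 with h | h
      · rw [e1 ⟨hy.1, h⟩, if_neg (not_lt.2 h.le)]; ring
      · rw [e2 ⟨h, hy.2⟩, if_pos h]; ring
    · obtain ⟨r, hr, hsub, hd⟩ := exists_radius F hx
      rw [Finset.erase_eq_of_notMem hxF] at hd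
      have hxe : x ∉ essJump a b u := by rwa [← hF, Finset.mem_coe]
      obtain ⟨r', hr', τ, hτ, h1⟩ := notMem_essJump hx hxe
      have hst := step_eq_or 1 (Or.inl rfl) F x
      refine hn.2 (min r r') (lt_min hr hr') (τ * step 1 F x) ?_ ?_
      · rcases hτ with rfl | rfl <;> rcases hst with h | h <;> simp [h]
      filter_upwards [ae_restrict_of_ae_restrict_of_subset (Ioo_subset_Ioo
        (by linarith [min_le_right r r']) (by linarith [min_le_right r r']) :
          Ioo (x - min r r') (x + min r r') ⊆ Ioo (x - r') (x + r')) h1,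
        ae_restrict_mem measurableSet_Ioo] with y e1 e2
      have e3 := step_eq_of_disjoint 1 hd (x := y) (y := x)
        ⟨by linarith [e2.1, min_le_left r r'], by linarith [e2.2, min_le_left r r']⟩
        ⟨by linarith, by linarith⟩
      rw [e1, e3]
  obtain ⟨σ, hσ, h⟩ := exists_ae_eq_of_disjoint_essJump hab le_rfl key
  refine ⟨σ, hσ, ?_⟩
  filter_upwards [h] with y hy
  have e : step σ F y = σ * step 1 F y := by simp [step]
  rw [e, ← hy]
  rcases step_eq_or 1 (Or.inl rfl) F y with h | h <;> rw [h] <;> ring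

theorem jumpSet_subset_essJump {a b : ℝ} (u : L1 a b) : jumpSet u ⊆ essJump a b u := by
  rintro x ⟨hx, hn⟩
  by_contra hxe
  obtain ⟨r, hr, σ, -, h⟩ := notMem_essJump hx hxe
  refine hn ⟨σ, tendsto_const_nhds.congr' ?_⟩
  filter_upwards [Ioo_mem_nhdsGT hr] with ρ hρ
  have e := ae_restrict_of_ae_restrict_of_subset (Ioo_subset_Ioo
    (by linarith [hρ.2]) (by linarith [hρ.2]) : Ioo (x - ρ) (x + ρ) ⊆ Ioo (x - r) (x + r)) h
  rw [setAverage_eq, integral_congr_ae (e.mono fun y hy => show |u y - σ| = 0 by simp [hy])]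
  simp

/-- Around an isolated sign change the mean of `|u - z|` is `(|-τ - z| + |τ - z|) / 2`, which is at
least `1` for every `z` by the triangle inequality. -/
theorem essJump_subset_jumpSet {a b : ℝ} {u : L1 a b} {F : Finset ℝ}
    (hF : (F : Set ℝ) = essJump a b u) : essJump a b u ⊆ jumpSet u := by
  intro x hx
  refine ⟨hx.1, ?_⟩
  rintro ⟨z, hz⟩
  rw [← hF, Finset.mem_coe] at hx
  obtain ⟨r, hr, hsub, -, τ, hτ, h1, h2⟩ := exists_sign_change hF hx
  have hlow : ∀ᶠ ρ in 𝓝[>] (0 : ℝ), 1 ≤ ⨍ y in Ioo (x - ρ) (x + ρ), |u y - z| := by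
    filter_upwards [Ioo_mem_nhdsGT hr] with ρ hρ
    have hρ0 : 0 < ρ := hρ.1
    have e1 : ∀ᵐ y, y ∈ Ioc (x - ρ) x → |u y - z| = |-τ - z| := by
      rw [ae_restrict_iff' measurableSet_Ioo] at h1
      filter_upwards [h1, Measure.ae_ne volume x] with y hy hne hm
      rw [hy ⟨by linarith [hm.1, hρ.2], lt_of_le_of_ne hm.2 hne⟩]
    have e2 : ∀ᵐ y, y ∈ Ioc x (x + ρ) → |u y - z| = |τ - z| := by
      rw [ae_restrict_iff' measurableSet_Ioo] at h2
      filter_upwards [h2] with y hy hm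
      rw [hy ⟨hm.1, by linarith [hm.2, hρ.2]⟩]
    have i1 : IntervalIntegrable (fun y => |u y - z|) volume (x - ρ) x := by
      rw [intervalIntegrable_iff_integrableOn_Ioc_of_le (by linarith)]
      exact (integrable_const (|-τ - z|)).congr
        (((ae_restrict_iff' measurableSet_Ioc).2 e1).mono fun y hy => hy.symm)
    have i2 : IntervalIntegrable (fun y => |u y - z|) volume x (x + ρ) := by
      rw [intervalIntegrable_iff_integrableOn_Ioc_of_le (by linarith)]
      exact (integrable_const (|τ - z|)).congr
        (((ae_restrict_iff' measurableSet_Ioc).2 e2).mono fun y hy => hy.symm)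
    have e3 : ∫ y in Ioo (x - ρ) (x + ρ), |u y - z| = ρ * |-τ - z| + ρ * |τ - z| := by
      rw [← integral_Ioc_eq_integral_Ioo, ← intervalIntegral.integral_of_le (by linarith),
        ← intervalIntegral.integral_add_adjacent_intervals i1 i2]
      congr 1
      · rw [intervalIntegral.integral_congr_ae (g := fun _ => |-τ - z|)
          (by rw [uIoc_of_le (by linarith)]; exact e1)]
        simp
      · rw [intervalIntegral.integral_congr_ae (g := fun _ => |τ - z|)
          (by rw [uIoc_of_le (by linarith)]; exact e2)]
        simp
    have e4 : volume.real (Ioo (x - ρ) (x + ρ)) = 2 * ρ := by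
      rw [Real.volume_real_Ioo_of_le (by linarith)]; ring
    rw [setAverage_eq, e3, e4, smul_eq_mul]
    have e5 : 2 ≤ |-τ - z| + |τ - z| := by
      have := abs_sub (τ - z) (-τ - z)
      have h3 : |τ - z - (-τ - z)| = 2 := by
        rw [show τ - z - (-τ - z) = 2 * τ by ring]
        rcases hτ with rfl | rfl <;> norm_num
      linarith
    rw [← mul_add, ← div_eq_inv_mul, le_div_iff₀ (by positivity)]
    nlinarith
  have := ge_of_tendsto hz hlow
  norm_num at this

theorem jumpSet_eq {a b : ℝ} {u : L1 a b} {F : Finset ℝ} (hF : (F : Set ℝ) = essJump a b u) :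
    jumpSet u = F :=
  (jumpSet_subset_essJump u).antisymm (essJump_subset_jumpSet hF) |>.trans hF.symm

theorem exists_between_forall_lt {F : Finset ℝ} {a s : ℝ} (has : a < s) (h : ∀ x ∈ F, x < s) :
    ∃ c ∈ Ioo a s, ∀ x ∈ F, x < c := by
  have h1 : ∀ᶠ c in 𝓝[<] s, ∀ x ∈ F, x < c :=
    (Finset.eventually_all F).2 fun x hx => mem_of_superset (Ioo_mem_nhdsLT (h x hx))
      fun c hc => hc.1
  obtain ⟨c, hc, hm⟩ := (h1.and (Ioo_mem_nhdsLT has)).exists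
  exact ⟨c, hm, hc⟩

/-- Around each jump both values are attained, which contributes variation `2`. Peeling off the
largest jump, behind a point `c` separating it from the others, keeps the contributions on disjoint
intervals. -/
theorem card_le_eVariationOn {a b : ℝ} {v : ℝ → ℝ}
    (hv : ∀ᵐ y ∂volume.restrict (Ioo a b), v y = 1 ∨ v y = -1) (F : Finset ℝ)
    (hF : (F : Set ℝ) ⊆ essJump a b v) :
    ∀ β, (∀ x ∈ F, x < β) → ((2 * F.card : ℕ) : ENNReal) ≤ eVariationOn v (Ioo a β ∩ Ioo a b) := by
  classical
  induction F using Finset.induction_on_max with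
  | empty => simp
  | insert s F hlt ih =>
    intro β hβ
    have hs : s ∈ essJump a b v := hF (Finset.mem_coe.2 (Finset.mem_insert_self s F))
    obtain ⟨c, hc, hcF⟩ := exists_between_forall_lt hs.1.1 hlt
    have h1 := ih (fun x hx => hF (Finset.mem_coe.2 (Finset.mem_insert_of_mem hx))) c hcF
    have hE : ∀ᵐ y ∂volume.restrict (Ioo a b), y ∈ (univ : Set ℝ) ∧ (v y = 1 ∨ v y = -1) :=
      hv.mono fun y hy => ⟨mem_univ _, hy⟩
    have hsβ : s < β := hβ s (Finset.mem_insert_self s F)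
    obtain ⟨p, hp, -, hvp⟩ := exists_mem_of_mem_essJump hs hc.2 hsβ hE (Or.inl rfl)
    obtain ⟨q, hq, -, hvq⟩ := exists_mem_of_mem_essJump hs hc.2 hsβ hE (Or.inr rfl)
    have h2 := eVariationOn.edist_le v hp hq
    rw [hvp, hvq, edist_dist, Real.dist_eq, show |(1 : ℝ) - -1| = ((2 : ℕ) : ℝ) by norm_num,
      ENNReal.ofReal_natCast] at h2
    rw [Finset.card_insert_of_notMem fun h => lt_irrefl s (hlt s h), mul_add, mul_one,
      Nat.cast_add]
    refine (add_le_add h1 h2).trans ((eVariationOn.add_le_union v fun x hx y hy =>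
      (hx.1.2.trans hy.1.1).le).trans (eVariationOn.mono v (union_subset ?_ ?_)))
    · exact inter_subset_inter_left _ (Ioo_subset_Ioo le_rfl (hc.2.trans hsβ).le)
    · exact inter_subset_inter_left _ (Ioo_subset_Ioo hc.1.le le_rfl)

theorem MemBVSign.finite_essJump {a b : ℝ} {u : L1 a b} (h : MemBVSign u) :
    (essJump a b u).Finite := by
  obtain ⟨h1, v, hvu, hbv⟩ := h
  have hv : ∀ᵐ y ∂volume.restrict (Ioo a b), v y = 1 ∨ v y = -1 := by
    filter_upwards [h1, hvu] with y hy e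
    rwa [e]
  refine Set.Finite.subset ?_ (essJump_congr hvu.symm)
  by_contra hinf
  obtain ⟨n, hn⟩ := ENNReal.exists_nat_gt hbv
  obtain ⟨F, hF, hcard⟩ := Set.Infinite.exists_subset_card_eq hinf n
  have h2 := card_le_eVariationOn hv F hF b fun x hx => (hF hx).1.2
  rw [inter_self, hcard] at h2
  have h3 : (n : ENNReal) ≤ ((2 * n : ℕ) : ENNReal) := by exact_mod_cast (by omega)
  exact absurd (h3.trans h2) (not_le.2 hn)

/-- Finiteness of the essential jumps already makes `u` a step function, so the lower bound needs to
count jumps only, without a compactness theorem in `BV`. -/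
theorem memBVSign_of_finite_essJump {a b : ℝ} (hab : a < b) {u : L1 a b}
    (h : (essJump a b u).Finite) : MemBVSign u := by
  obtain ⟨σ, hσ, hu⟩ := exists_ae_eq_step hab (F := h.toFinset) h.coe_toFinset
  refine ⟨hu.mono fun x hx => ?_, step σ h.toFinset, hu.symm, boundedVariationOn_step _ _ _⟩
  rw [hx]
  exact step_eq_or σ hσ _ x

theorem limitEnergy_eq {a b : ℝ} (hab : a < b) (W : ℝ → ℝ) (k : ℝ) {u : L1 a b} {F : Finset ℝ}
    (hF : (F : Set ℝ) = essJump a b u) :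
    limitEnergy W k a b u = optimalProfile W k * ((F.card : ℝ) : EReal) := by
  rw [limitEnergy, if_pos (memBVSign_of_finite_essJump hab (hF ▸ F.finite_toSet)), jumpSet_eq hF,
    Set.encard_coe_eq_coe_finsetCard]
  congr 1

/-! ### The lower bound. -/

theorem scaledEnergy_neg_one_ge {W : ℝ → ℝ} (hW : IsDoubleWell W) {U V w : ℝ → ℝ}
    (h : IsH2 U V w) {ε x y : ℝ} (hε : 0 < ε) (hxy : x ≤ y) :
    ε⁻¹ * ∫ t in x..y, (W (U t) + (ε * V t) ^ 2) ≤ scaledEnergy W (-1) ε U V w x y := by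
  rw [← intervalIntegral.integral_const_mul]
  refine intervalIntegral.integral_mono_on hxy ?_ (h.intervalIntegrable_energy hW.continuous _ _ _ _ _)
    fun t _ => ?_
  · have hU := h.fst.continuous
    have hV := h.snd.continuous
    have hWc := hW.continuous
    exact Continuous.intervalIntegrable (by fun_prop) _ _
  · have e : ε⁻¹ * (W (U t) + (ε * V t) ^ 2) = W (U t) / ε - -1 * ε * V t ^ 2 := by
      field_simp
      ring
    rw [e]
    have : 0 ≤ ε ^ 3 * w t ^ 2 := by positivity
    linarith

theorem scaledEnergy_neg_one_nonneg {W : ℝ → ℝ} (hW : IsDoubleWell W) {U V w : ℝ → ℝ}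
    (h : IsH2 U V w) {ε x y : ℝ} (hε : 0 < ε) (hxy : x ≤ y) :
    0 ≤ scaledEnergy W (-1) ε U V w x y := by
  refine le_trans ?_ (scaledEnergy_neg_one_ge hW h hε hxy)
  refine mul_nonneg (by positivity) (intervalIntegral.integral_nonneg hxy fun t _ => ?_)
  exact add_nonneg (hW.nonneg _) (sq_nonneg _)

theorem exists_subseq_ae_tendsto_zero {a b : ℝ} (hab : a ≤ b) {g : ℕ → ℝ → ℝ}
    (hg : ∀ n, Continuous (g n)) (h0 : ∀ n x, 0 ≤ g n x)
    (h : Tendsto (fun n => ∫ x in a..b, g n x) atTop (𝓝 0)) :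
    ∃ θ : ℕ → ℕ, StrictMono θ ∧
      ∀ᵐ x ∂volume.restrict (Ioo a b), Tendsto (fun n => g (θ n) x) atTop (𝓝 0) := by
  refine TendstoInMeasure.exists_seq_tendsto_ae (g := fun _ => (0 : ℝ))
    (tendstoInMeasure_of_tendsto_eLpNorm (p := 1) one_ne_zero
      (fun n => (hg n).aestronglyMeasurable) aestronglyMeasurable_const ?_)
  have e : ∀ n, eLpNorm (g n - fun _ => (0 : ℝ)) 1 (volume.restrict (Ioo a b)) =
      ENNReal.ofReal (∫ x in a..b, g n x) := by
    intro n
    have hi : Integrable (g n) (volume.restrict (Ioo a b)) :=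
      ((hg n).integrableOn_Icc (a := a) (b := b)).mono_set Ioo_subset_Icc_self
    rw [eLpNorm_one_eq_lintegral_enorm, intervalIntegral.integral_of_le hab,
      integral_Ioc_eq_integral_Ioo]
    have h1 : (g n - fun _ => (0 : ℝ)) = g n := by funext x; simp
    rw [h1, ← ofReal_integral_norm_eq_lintegral_enorm hi]
    congr 1
    refine integral_congr_ae (ae_of_all _ fun x => ?_)
    exact Real.norm_of_nonneg (h0 n x)
  simp only [e]
  rw [← ENNReal.ofReal_zero]
  exact (ENNReal.continuous_ofReal.tendsto 0).comp h

section LowerBound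

variable {W : ℝ → ℝ} (hW : IsDoubleWell W) {k₀ k : ℝ} (hk₀ : 0 < k₀)
  (hk : IsInterpolationConstant W k₀) (hkk : k < k₀)
include hW hk₀ hk hkk

/-- A fixed interval is eventually longer than `L ε`, so coercivity applies to it. The leftover
intervals between transitions are discarded by this. -/
theorem eventually_scaledEnergy_nonneg {ε : ℕ → ℝ} (hε : ∀ n, 0 < ε n)
    (hε0 : Tendsto ε atTop (𝓝 0)) {U V w : ℕ → ℝ → ℝ} (h : ∀ n, IsH2 (U n) (V n) (w n))
    {x y : ℝ} (hxy : x < y) :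
    ∀ᶠ n in atTop, 0 ≤ scaledEnergy W k (ε n) (U n) (V n) (w n) x y := by
  obtain ⟨η, L, hη, hL, H⟩ := hW.exists_coercive hk₀ hk hkk
  have h1 : Tendsto (fun n => L * ε n) atTop (𝓝 0) := by simpa using hε0.const_mul L
  filter_upwards [h1.eventually (gt_mem_nhds (sub_pos.2 hxy))] with n hn
  exact (mul_nonneg hη.le (scaledEnergy_neg_one_nonneg hW (h n) (hε n) hxy.le)).trans
    (H _ _ _ (h n) _ _ _ (hε n) hn.le)

/-- Each essential jump of the limit costs at least the optimal-profile constant. -/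
theorem eventually_card_mul_le {m δ : ℝ} (hm : (m : EReal) ≤ optimalProfile W k) (hδ : 0 < δ)
    {a b : ℝ} {ε : ℕ → ℝ} (hε : ∀ n, 0 < ε n)
    (hε0 : Tendsto ε atTop (𝓝 0)) {U V w : ℕ → ℝ → ℝ} (h : ∀ n, IsH2 (U n) (V n) (w n))
    {u : ℝ → ℝ} (hu : ∀ᵐ x ∂volume.restrict (Ioo a b), u x = 1 ∨ u x = -1)
    (hU : ∀ᵐ x ∂volume.restrict (Ioo a b), Tendsto (fun n => U n x) atTop (𝓝 (u x)))
    (hV : ∀ᵐ x ∂volume.restrict (Ioo a b), Tendsto (fun n => ε n * V n x) atTop (𝓝 0))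
    (F : Finset ℝ) (hF : (F : Set ℝ) ⊆ essJump a b u) :
    ∀ β, a < β → (∀ x ∈ F, x < β) →
      ∀ᶠ n in atTop, F.card * (m - δ) ≤ scaledEnergy W k (ε n) (U n) (V n) (w n) a β := by
  classical
  obtain ⟨γ, hγ, H⟩ := exists_transition hW hm hδ
  -- The right end `β` varies in the induction: the earlier jumps are charged to `[a, c]` and the
  -- largest one to `[c, β]`.
  induction F using Finset.induction_on_max with
  | empty =>
    intro β hβ _
    simpa using eventually_scaledEnergy_nonneg hW hk₀ hk hkk hε hε0 h hβ
  | insert s F hlt ih =>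
    intro β _ hβ
    have hs : s ∈ essJump a b u := hF (Finset.mem_coe.2 (Finset.mem_insert_self s F))
    have hsβ : s < β := hβ s (Finset.mem_insert_self s F)
    obtain ⟨c, hc, hcF⟩ := exists_between_forall_lt hs.1.1 hlt
    have hE : ∀ᵐ x ∂volume.restrict (Ioo a b), x ∈ {x | Tendsto (fun n => U n x) atTop (𝓝 (u x)) ∧
        Tendsto (fun n => ε n * V n x) atTop (𝓝 0)} ∧ (u x = 1 ∨ u x = -1) := by
      filter_upwards [hu, hU, hV] with x h1 h2 h3 using ⟨⟨h2, h3⟩, h1⟩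
    obtain ⟨p, hp, hpE, hup⟩ := exists_mem_of_mem_essJump hs hc.2 hsβ hE (Or.inl rfl)
    obtain ⟨q, hq, hqE, huq⟩ := exists_mem_of_mem_essJump hs hc.2 hsβ hE (Or.inr rfl)
    have hne : p ≠ q := by
      rintro rfl
      rw [hup] at huq
      norm_num at huq
    -- Which of the two values is met first is unknown; `σ` records the direction of the transition.
    have hpq : ∃ p q σ, c < p ∧ p < q ∧ q < β ∧ (σ = 1 ∨ σ = -1) ∧
        Tendsto (fun n => U n p) atTop (𝓝 σ) ∧ Tendsto (fun n => ε n * V n p) atTop (𝓝 0) ∧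
        Tendsto (fun n => U n q) atTop (𝓝 (-σ)) ∧
        Tendsto (fun n => ε n * V n q) atTop (𝓝 0) := by
      have a1 := hpE.1
      have a2 := hqE.1
      rw [hup] at a1
      rw [huq] at a2
      rcases lt_or_gt_of_ne hne with hlt | hlt
      · exact ⟨p, q, 1, hp.1.1, hlt, hq.1.2, Or.inl rfl, a1, hpE.2, a2, hqE.2⟩
      · exact ⟨q, p, -1, hq.1.1, hlt, hp.1.2, Or.inr rfl, a2, hqE.2, by rwa [neg_neg], hpE.2⟩
    obtain ⟨p, q, σ, hcp, hpq, hqβ, hσ, t1, t2, t3, t4⟩ := hpq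
    have e1 := ih (fun x hx => hF (Finset.mem_coe.2 (Finset.mem_insert_of_mem hx))) c hc.1 hcF
    have e2 := eventually_scaledEnergy_nonneg hW hk₀ hk hkk hε hε0 h hcp
    have e3 := eventually_scaledEnergy_nonneg hW hk₀ hk hkk hε hε0 h hqβ
    filter_upwards [e1, e2, e3, t1.eventually (Metric.ball_mem_nhds _ hγ),
      t2.eventually (Metric.ball_mem_nhds _ hγ), t3.eventually (Metric.ball_mem_nhds _ hγ),
      t4.eventually (Metric.ball_mem_nhds _ hγ)] with n h1 h2 h3 h4 h5 h6 h7
    rw [Real.dist_eq] at h4 h5 h6 h7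
    rw [sub_zero] at h5 h7
    rw [sub_neg_eq_add] at h6
    have h8 := H _ _ _ (h n) σ (ε n) p q hσ (hε n) hpq.le h4 h5 h6 h7
    rw [← scaledEnergy_add hW.continuous (h n) k (ε n) a c β,
      ← scaledEnergy_add hW.continuous (h n) k (ε n) c p β,
      ← scaledEnergy_add hW.continuous (h n) k (ε n) p q β,
      Finset.card_insert_of_notMem fun h => lt_irrefl s (hlt s h)]
    push_cast
    linarith

/-- By coercivity `∫ (W(U) + (ε V)²)` is at most `ε C / η`, so it tends to zero. A subsequence
converges almost everywhere, which puts the limit into the wells and makes the rescaled slopes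
vanish at almost every point, as the count of transitions requires. -/
theorem card_mul_le {m C : ℝ} (hm : (m : EReal) ≤ optimalProfile W k)
    {a b : ℝ} (hab : a < b) {ε : ℕ → ℝ} (hε : ∀ n, 0 < ε n)
    (hε0 : Tendsto ε atTop (𝓝 0)) {U V w : ℕ → ℝ → ℝ} (h : ∀ n, IsH2 (U n) (V n) (w n))
    (hC : ∀ n, scaledEnergy W k (ε n) (U n) (V n) (w n) a b ≤ C) {u : ℝ → ℝ}
    (hU : ∀ᵐ x ∂volume.restrict (Ioo a b), Tendsto (fun n => U n x) atTop (𝓝 (u x)))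
    (F : Finset ℝ) (hF : (F : Set ℝ) ⊆ essJump a b u) : F.card * m ≤ C := by
  obtain ⟨η, L, hη, hL, H⟩ := hW.exists_coercive hk₀ hk hkk
  have hWc := hW.continuous
  set g : ℕ → ℝ → ℝ := fun n x => W (U n x) + (ε n * V n x) ^ 2 with hg
  have hg0 : ∀ n x, 0 ≤ g n x := fun n x => add_nonneg (hW.nonneg _) (sq_nonneg _)
  have hgc : ∀ n, Continuous (g n) := fun n => by
    have := (h n).fst.continuous
    have := (h n).snd.continuous
    fun_prop
  have hlim : Tendsto (fun n => ∫ x in a..b, g n x) atTop (𝓝 0) := by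
    have hup : Tendsto (fun n => ε n * (C / η)) atTop (𝓝 0) := by
      simpa using hε0.mul_const (C / η)
    have h1 : Tendsto (fun n => L * ε n) atTop (𝓝 0) := by simpa using hε0.const_mul L
    refine tendsto_of_tendsto_of_tendsto_of_le_of_le' tendsto_const_nhds hup
      (Eventually.of_forall fun n => intervalIntegral.integral_nonneg hab.le fun t _ => hg0 n t) ?_
    filter_upwards [h1.eventually (gt_mem_nhds (sub_pos.2 hab))] with n hn
    have e1 := (H _ _ _ (h n) _ _ _ (hε n) hn.le).trans (hC n)
    have e2 := scaledEnergy_neg_one_ge hW (h n) (hε n) hab.le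
    rw [inv_mul_le_iff₀ (hε n)] at e2
    refine e2.trans (mul_le_mul_of_nonneg_left ?_ (hε n).le)
    rwa [le_div_iff₀' hη]
  obtain ⟨θ, hθ, hae⟩ := exists_subseq_ae_tendsto_zero hab.le hgc hg0 hlim
  have hU' : ∀ᵐ x ∂volume.restrict (Ioo a b),
      Tendsto (fun n => U (θ n) x) atTop (𝓝 (u x)) :=
    hU.mono fun x hx => hx.comp hθ.tendsto_atTop
  have hu : ∀ᵐ x ∂volume.restrict (Ioo a b), u x = 1 ∨ u x = -1 := by
    filter_upwards [hU', hae] with x h1 h2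
    have h3 : Tendsto (fun n => W (U (θ n) x)) atTop (𝓝 (W (u x))) :=
      (hWc.tendsto _).comp h1
    have h4 : Tendsto (fun n => W (U (θ n) x)) atTop (𝓝 0) :=
      squeeze_zero (fun n => hW.nonneg _) (fun n => le_add_of_nonneg_right (sq_nonneg _)) h2
    exact (hW.eq_zero_iff _).1 (tendsto_nhds_unique h3 h4)
  have hV' : ∀ᵐ x ∂volume.restrict (Ioo a b),
      Tendsto (fun n => ε (θ n) * V (θ n) x) atTop (𝓝 0) := by
    filter_upwards [hae] with x h2
    have h4 : Tendsto (fun n => (ε (θ n) * V (θ n) x) ^ 2) atTop (𝓝 0) :=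
      squeeze_zero (fun n => sq_nonneg _) (fun n => le_add_of_nonneg_left (hW.nonneg _)) h2
    have h5 := h4.sqrt
    simp only [Real.sqrt_sq_eq_abs, Real.sqrt_zero] at h5
    exact (tendsto_zero_iff_abs_tendsto_zero _).2 h5
  have hδ : ∀ δ : ℝ, 0 < δ → F.card * (m - δ) ≤ C := by
    intro δ hδ
    obtain ⟨n, hn⟩ := (eventually_card_mul_le hW hk₀ hk hkk hm hδ (fun n => hε (θ n))
      (hε0.comp hθ.tendsto_atTop) (fun n => h (θ n)) hu hU' hV' F hF b hab
      fun x hx => (hF hx).1.2).exists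
    exact hn.trans (hC _)
  have hcont : Tendsto (fun δ : ℝ => F.card * (m - δ)) (𝓝[>] 0) (𝓝 (F.card * (m - 0))) :=
    ((continuous_const.mul (continuous_const.sub continuous_id)).tendsto 0).mono_left
      nhdsWithin_le_nhds
  rw [sub_zero] at hcont
  exact le_of_tendsto hcont (by filter_upwards [self_mem_nhdsWithin] with δ h using hδ δ h)

theorem exists_optimalProfile_eq : ∃ M : ℝ, 0 < M ∧ optimalProfile W k = (M : EReal) := by
  obtain ⟨μ, hμ, hle⟩ := exists_pos_le_optimalProfile hW hk₀ hk hkk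
  have h1 : optimalProfile W k ≠ ⊤ := (optimalProfile_lt_top hW k).ne
  have h2 : optimalProfile W k ≠ ⊥ := ((EReal.bot_lt_coe μ).trans_le hle).ne'
  refine ⟨(optimalProfile W k).toReal, ?_, (EReal.coe_toReal h1 h2).symm⟩
  rw [← EReal.coe_toReal h1 h2, EReal.coe_le_coe_iff] at hle
  exact hμ.trans_le hle

theorem limitEnergy_le_of_frequently {a b : ℝ} (hab : a < b) {ε : ℕ → ℝ} (hε : ∀ n, 0 < ε n)
    (hε0 : Tendsto ε atTop (𝓝 0)) {u : L1 a b} {v : ℕ → L1 a b} (hv : Tendsto v atTop (𝓝 u))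
    {C : ℝ} (hC : ∃ᶠ n in atTop, energy W k a b (ε n) (v n) < C) :
    limitEnergy W k a b u ≤ C := by
  obtain ⟨φ, hφ, hφC⟩ := extraction_of_frequently_atTop hC
  obtain ⟨ψ, hψ, hae⟩ := (tendstoInMeasure_of_tendsto_Lp
    (hv.comp hφ.tendsto_atTop)).exists_seq_tendsto_ae
  have hH : ∀ n, ∃ U V w : ℝ → ℝ, IsH2 U V w ∧
      (v (φ (ψ n)) : ℝ → ℝ) =ᵐ[volume.restrict (Ioo a b)] U := by
    intro n
    -- An energy below the real number `C` is not `+∞`, which forces membership in `W^{2,2}`.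
    by_cases hmem : MemW22 (Ioo a b) (v (φ (ψ n)))
    · exact hmem.exists_isH2 hab
    · have := hφC (ψ n)
      rw [energy, if_neg hmem] at this
      exact absurd this (not_lt.2 le_top)
  choose U V w h hU using hH
  have hCn : ∀ n, scaledEnergy W k (ε (φ (ψ n))) (U n) (V n) (w n) a b ≤ C := by
    intro n
    have := hφC (ψ n)
    rw [energy_eq_scaledEnergy (h n) hab.le k _ (hU n), EReal.coe_lt_coe_iff] at this
    exact this.le
  have hUae : ∀ᵐ x ∂volume.restrict (Ioo a b), Tendsto (fun n => U n x) atTop (𝓝 (u x)) := by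
    filter_upwards [hae, ae_all_iff.2 hU] with x h1 h2
    refine h1.congr fun n => ?_
    exact h2 n
  obtain ⟨M, hM, hMe⟩ := exists_optimalProfile_eq hW hk₀ hk hkk
  have key := fun F hF => card_mul_le hW hk₀ hk hkk hMe.ge hab (fun n => hε (φ (ψ n)))
    (hε0.comp (hφ.tendsto_atTop.comp hψ.tendsto_atTop)) h hCn hUae F hF
  -- Infinitely many jumps would give `n M ≤ C` for every `n`, which `M > 0` excludes.
  have hfin : (essJump a b u).Finite := by
    by_contra hinf
    obtain ⟨n, hn⟩ := exists_nat_gt (C / M)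
    obtain ⟨F, hF, hcard⟩ := Set.Infinite.exists_subset_card_eq hinf n
    have := key F hF
    rw [hcard] at this
    rw [div_lt_iff₀ hM] at hn
    linarith
  have := key hfin.toFinset (by simp)
  rw [limitEnergy_eq hab W k (F := hfin.toFinset) hfin.coe_toFinset, hMe, ← EReal.coe_mul,
    EReal.coe_le_coe_iff, mul_comm]
  exact this

theorem limitEnergy_le_liminf {a b : ℝ} (hab : a < b) {ε : ℕ → ℝ} (hε : ∀ n, 0 < ε n)
    (hε0 : Tendsto ε atTop (𝓝 0)) {u : L1 a b} {v : ℕ → L1 a b} (hv : Tendsto v atTop (𝓝 u)) :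
    limitEnergy W k a b u ≤ liminf (fun n => energy W k a b (ε n) (v n)) atTop := by
  by_contra hn
  obtain ⟨C, h1, h2⟩ := EReal.lt_iff_exists_real_btwn.1 (not_le.1 hn)
  exact absurd (limitEnergy_le_of_frequently hW hk₀ hk hkk hab hε hε0 hv
    (frequently_lt_of_liminf_lt (by isBoundedDefault) h1)) (not_le.2 h2)

end LowerBound

/-! ### The upper bound. -/

/-- A profile, or the reflection of it, as a transition from `-σ` to `σ` inside `[-T, T]`. -/
theorem IsProfile.exists_transition {W U V w : ℝ → ℝ} {s t : ℝ} (hW : IsDoubleWell W) (k : ℝ)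
    (h : IsProfile U V w s t) : ∃ T > 0, ∃ B > 0, ∀ σ : ℝ, σ = 1 ∨ σ = -1 → ∃ P P' P'' : ℝ → ℝ,
      IsH2 P P' P'' ∧ (∀ x ≤ -T, P x = -σ ∧ P' x = 0) ∧ (∀ x, T ≤ x → P x = σ ∧ P' x = 0) ∧
      (∀ x, |P x| ≤ B) ∧ ∀ x y, x ≤ -T → T ≤ y →
        scaledEnergy W k 1 P P' P'' x y = scaledEnergy W k 1 U V w s t := by
  set T := max (-s) t + max 1 (s - t) with hT
  have hst := h.le
  have hs : -T < s := by
    have := le_max_left (-s) t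
    have := le_max_left 1 (s - t)
    linarith
  have ht : t < T := by
    have := le_max_right (-s) t
    have := le_max_left 1 (s - t)
    linarith
  have hT0 : 0 < T := by linarith
  obtain ⟨B, hB⟩ := (isCompact_Icc (a := -T) (b := T)).exists_bound_of_continuousOn
    h.isH2.fst.continuous.continuousOn
  have hbd : ∀ x, |U x| ≤ max B 1 := by
    intro x
    by_cases hx : x ∈ Icc (-T) T
    · exact (hB x hx).trans (le_max_left _ _)
    · rw [mem_Icc, not_and_or, not_le, not_le] at hx
      refine le_trans ?_ (le_max_right _ _)
      rcases hx with hx | hx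
      · rw [(h.left x (by linarith)).1]; norm_num
      · rw [(h.right x (by linarith)).1]; norm_num
  have hen : ∀ x y, x ≤ -T → T ≤ y →
      scaledEnergy W k 1 U V w x y = scaledEnergy W k 1 U V w s t := by
    intro x y hx hy
    -- Both energies are the same integral over the whole line.
    rw [← h.integral_eq hW k EventuallyEq.rfl,
      ← (h.mono (s' := x) (t' := y) (by linarith) (by linarith)).integral_eq hW k EventuallyEq.rfl]
  refine ⟨T, hT0, max B 1, by positivity, ?_⟩
  rintro σ (rfl | rfl)
  · refine ⟨U, V, w, h.isH2, fun x hx => ?_, fun x hx => ?_, hbd, hen⟩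
    · exact ⟨(h.left x (by linarith)).1, (h.left x (by linarith)).2.1⟩
    · exact ⟨(h.right x (by linarith)).1, (h.right x (by linarith)).2.1⟩
  · refine ⟨_, _, _, h.isH2.affine (show (-1 : ℝ) ≠ 0 by norm_num) 0, fun x hx => ?_,
      fun x hx => ?_, fun x => hbd _, fun x y hx hy => ?_⟩
    · obtain ⟨h1, h2, -⟩ := h.right (-1 * x + 0) (by linarith)
      simp only [h1, h2]
      norm_num
    · obtain ⟨h1, h2, -⟩ := h.left (-1 * x + 0) (by linarith)
      simp only [h1, h2]
      norm_num
    · rw [scaledEnergy_neg, hen _ _ (by linarith) (by linarith)]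

theorem intervalIntegrable_abs_sub_step {U : ℝ → ℝ} (hU : Continuous U) {σ : ℝ}
    (hσ : σ = 1 ∨ σ = -1) (F : Finset ℝ) (x y : ℝ) :
    IntervalIntegrable (fun t => |U t - step σ F t|) volume x y := by
  refine IntervalIntegrable.abs ((hU.intervalIntegrable x y).sub ?_)
  refine (intervalIntegrable_const (c := (1 : ℝ))).mono_fun
    (measurable_step σ F).aestronglyMeasurable (ae_of_all _ fun t => ?_)
  rcases step_eq_or σ hσ F t with h | h <;> simp [h]

section Recovery

variable {W : ℝ → ℝ} (hW : IsDoubleWell W) (k : ℝ)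
include hW

/-- Reaching `β` with value `σ` and zero slope is what lets the induction continue: the construction
for the earlier jumps ends at `-σ` at `c`, and the next rescaled profile starts there. The energies
add up exactly. -/
theorem exists_recovery {U₀ V₀ w₀ : ℝ → ℝ} {s₀ t₀ : ℝ} (h₀ : IsProfile U₀ V₀ w₀ s₀ t₀) {α : ℝ}
    (F : Finset ℝ) (hF : ∀ x ∈ F, α < x) : ∀ σ : ℝ, σ = 1 ∨ σ = -1 → ∀ β, α < β →
      (∀ x ∈ F, x < β) → ∀ δ > 0, ∀ᶠ ε in 𝓝[>] (0 : ℝ), ∃ U V w : ℝ → ℝ, IsH2 U V w ∧ U β = σ ∧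
        V β = 0 ∧ (∫ x in α..β, |U x - step σ F x|) ≤ δ ∧
        scaledEnergy W k ε U V w α β = F.card * scaledEnergy W k 1 U₀ V₀ w₀ s₀ t₀ := by
  classical
  obtain ⟨T, hT, B, hB, htr⟩ := h₀.exists_transition hW k
  induction F using Finset.induction_on_max with
  | empty =>
    intro σ hσ β hβ _ δ hδ
    refine Eventually.of_forall fun ε => ⟨fun _ => σ, 0, 0, IsH2.const σ, rfl, rfl, ?_, ?_⟩
    · simpa [step_empty] using hδ.le
    · simp [scaledEnergy, (hW.eq_zero_iff σ).2 hσ]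
  | insert s F hlt ih =>
    intro σ hσ β _ hβ δ hδ
    have hsF : s ∉ F := fun h => lt_irrefl s (hlt s h)
    have hsβ : s < β := hβ s (Finset.mem_insert_self s F)
    obtain ⟨c, hc, hcF⟩ := exists_between_forall_lt (hF s (Finset.mem_insert_self s F)) hlt
    have hσ' : -σ = 1 ∨ -σ = -1 := by rcases hσ with rfl | rfl <;> simp
    have e1 := ih (fun x hx => hF x (Finset.mem_insert_of_mem hx)) (-σ) hσ' c hc.1 hcF (δ / 2)
      (half_pos hδ)
    obtain ⟨P, P', P'', hP, hl, hr, hbd, hen⟩ := htr σ hσ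
    -- The first two bounds keep the transition layer `[s - ε T, s + ε T]` inside `(c, β)`. The
    -- third makes its `L¹` error, at most `2 ε T (B + 1)`, smaller than `δ / 2`.
    have hρ : 0 < min (min ((s - c) / T) ((β - s) / T)) (δ / 2 / (2 * T * (B + 1))) :=
      lt_min (lt_min (div_pos (sub_pos.2 hc.2) hT) (div_pos (sub_pos.2 hsβ) hT)) (by positivity)
    filter_upwards [e1, Ioo_mem_nhdsGT hρ] with ε ⟨U, V, w, hH, hUc, hVc, hint, hE⟩ hε
    have hε0 : 0 < ε := hε.1
    have b1 : ε * T < s - c := (lt_div_iff₀ hT).1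
      (hε.2.trans_le ((min_le_left _ _).trans (min_le_left _ _)))
    have b2 : ε * T < β - s := (lt_div_iff₀ hT).1
      (hε.2.trans_le ((min_le_left _ _).trans (min_le_right _ _)))
    have b3 : ε * (2 * T * (B + 1)) < δ / 2 := (lt_div_iff₀ (by positivity)).1
      (hε.2.trans_le (min_le_right _ _))
    have hεT : 0 < ε * T := by positivity
    have hQ := hP.affine (inv_ne_zero hε0.ne') (-(ε⁻¹ * s))
    have arg : ∀ x, ε⁻¹ * x + -(ε⁻¹ * s) = (x - s) / ε := fun x => by field_simp; ring
    have argl : ∀ x, x ≤ s - ε * T → ε⁻¹ * x + -(ε⁻¹ * s) ≤ -T := by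
      intro x hx
      rw [arg, div_le_iff₀ hε0]
      linarith
    have argr : ∀ x, s + ε * T ≤ x → T ≤ ε⁻¹ * x + -(ε⁻¹ * s) := by
      intro x hx
      rw [arg, le_div_iff₀ hε0]
      linarith
    set Q : ℝ → ℝ := fun x => P (ε⁻¹ * x + -(ε⁻¹ * s)) with hQdef
    set Q' : ℝ → ℝ := fun x => ε⁻¹ * P' (ε⁻¹ * x + -(ε⁻¹ * s)) with hQ'def
    have Ql : ∀ x, x ≤ s - ε * T → Q x = -σ ∧ Q' x = 0 := fun x hx => by
      simp only [hQdef, hQ'def, (hl _ (argl x hx)).1, (hl _ (argl x hx)).2, mul_zero, and_self]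
    have Qr : ∀ x, s + ε * T ≤ x → Q x = σ ∧ Q' x = 0 := fun x hx => by
      simp only [hQdef, hQ'def, (hr _ (argr x hx)).1, (hr _ (argr x hx)).2, mul_zero, and_self]
    have hcQ := Ql c (by linarith)
    have hβQ := Qr β (by linarith)
    have hcβ : c < β := hc.2.trans hsβ
    have jU : U c = Q c := hUc.trans hcQ.1.symm
    have jV : V c = Q' c := hVc.trans hcQ.2.symm
    have hG := hH.glue hQ jU jV
    refine ⟨_, _, _, hG, ?_, ?_, ?_, ?_⟩
    · rw [glue_of_lt _ _ hcβ, hβQ.1]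
    · rw [glue_of_lt _ _ hcβ, hβQ.2]
    · have i := intervalIntegrable_abs_sub_step hG.fst.continuous hσ (insert s F)
      have iQ := intervalIntegrable_abs_sub_step hQ.fst.continuous hσ (insert s F)
      have I1 : ∫ x in α..c, |glue c U Q x - step σ (insert s F) x| =
          ∫ x in α..c, |U x - step (-σ) F x| := by
        refine intervalIntegral.integral_congr fun x hx => ?_
        rw [uIcc_of_le hc.1.le] at hx
        simp only [glue_of_le _ _ hx.2]
        rw [step_insert σ hsF, step_neg, if_neg (not_lt.2 (hx.2.trans hc.2.le)), neg_one_mul]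
      have I2 : ∫ x in c..β, |glue c U Q x - step σ (insert s F) x| =
          ∫ x in c..β, |Q x - step σ (insert s F) x| := by
        refine intervalIntegral.integral_congr_ae (ae_of_all _ fun x hx => ?_)
        rw [uIoc_of_le hcβ.le] at hx
        simp only [glue_of_lt _ _ hx.1]
      have stepl : ∀ x, c ≤ x → x ≤ s → step σ (insert s F) x = -σ := by
        intro x hx1 hx2
        rw [step_insert σ hsF, if_neg (not_lt.2 hx2),
          step_of_forall_lt σ fun y hy => (hcF y hy).trans_le hx1, neg_one_mul]
      have stepr : ∀ x, s < x → step σ (insert s F) x = σ := by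
        intro x hx
        rw [step_insert σ hsF, if_pos hx,
          step_of_forall_lt σ fun y hy => (hlt y hy).trans hx, one_mul]
      have I3 : ∫ x in c..(s - ε * T), |Q x - step σ (insert s F) x| = 0 := by
        rw [intervalIntegral.integral_congr (g := fun _ => (0 : ℝ)) fun x hx => ?_]
        · simp
        · rw [uIcc_of_le (by linarith)] at hx
          simp only [(Ql x hx.2).1, stepl x hx.1 (by linarith [hx.2]), sub_self, abs_zero]
      have I4 : ∫ x in (s + ε * T)..β, |Q x - step σ (insert s F) x| = 0 := by
        rw [intervalIntegral.integral_congr (g := fun _ => (0 : ℝ)) fun x hx => ?_]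
        · simp
        · rw [uIcc_of_le (by linarith)] at hx
          simp only [(Qr x hx.1).1, stepr x (by linarith [hx.1]), sub_self, abs_zero]
      have I5 : ∫ x in (s - ε * T)..(s + ε * T), |Q x - step σ (insert s F) x| ≤
          (s + ε * T - (s - ε * T)) * (B + 1) := by
        refine integral_le_const_mul (by linarith) (iQ _ _) fun x _ => ?_
        refine (abs_sub _ _).trans (add_le_add (hbd _) ?_)
        rcases step_eq_or σ hσ (insert s F) x with h | h <;> simp [h]
      rw [← intervalIntegral.integral_add_adjacent_intervals (i α c) (i c β), I1, I2,
        ← intervalIntegral.integral_add_adjacent_intervals (iQ c (s - ε * T)) (iQ (s - ε * T) β),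
        ← intervalIntegral.integral_add_adjacent_intervals (iQ (s - ε * T) (s + ε * T))
          (iQ (s + ε * T) β), I3, I4]
      linarith
    · rw [scaledEnergy_glue k ε hc.1.le hcβ.le hW.continuous hH hQ jU jV, hE,
        scaledEnergy_affine W k (inv_pos.2 hε0), mul_inv_cancel₀ hε0.ne',
        hen _ _ (argl c (by linarith)) (argr β (by linarith)),
        Finset.card_insert_of_notMem hsF]
      push_cast
      ring

theorem exists_isProfile_lt {M δ : ℝ} (hM : optimalProfile W k = (M : EReal)) (hδ : 0 < δ) :
    ∃ U V w s t, IsProfile U V w s t ∧ scaledEnergy W k 1 U V w s t < M + δ := by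
  have h : optimalProfile W k < ((M + δ : ℝ) : EReal) := by
    rw [hM, EReal.coe_lt_coe_iff]
    linarith
  rw [optimalProfile] at h
  simp only [iInf_lt_iff] at h
  obtain ⟨f, hf, hlt⟩ := h
  obtain ⟨U, V, w, s, t, hp, hfU⟩ := exists_isProfile hf
  rw [hp.integral_eq hW k hfU, EReal.coe_lt_coe_iff] at hlt
  exact ⟨U, V, w, s, t, hp, hlt⟩

theorem eventually_exists_energy_le {M : ℝ} (hM : optimalProfile W k = (M : EReal)) {a b : ℝ}
    (hab : a < b) {u : L1 a b} {F : Finset ℝ} (hF : (F : Set ℝ) = essJump a b u) {δ : ℝ}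
    (hδ : 0 < δ) : ∀ᶠ ε in 𝓝[>] (0 : ℝ), ∃ v : L1 a b, dist v u ≤ δ ∧
      energy W k a b ε v ≤ ((F.card * M + δ : ℝ) : EReal) := by
  obtain ⟨σ, hσ, hu⟩ := exists_ae_eq_step hab hF
  -- The excess is shared among the jumps; adding one to their number avoids a division by zero when
  -- there are none.
  obtain ⟨U₀, V₀, w₀, s₀, t₀, h₀, hlt⟩ := exists_isProfile_lt hW k hM
    (show 0 < δ / (F.card + 1) by positivity)
  have hmem : ∀ x ∈ F, x ∈ Ioo a b := fun x hx => (hF.subset (Finset.mem_coe.2 hx)).1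
  filter_upwards [exists_recovery hW k h₀ F (fun x hx => (hmem x hx).1) σ hσ b hab
    (fun x hx => (hmem x hx).2) δ hδ] with ε ⟨U, V, w, hH, _, _, hint, hE⟩
  have hL : MemLp U 1 (volume.restrict (Ioo a b)) := memLp_one_iff_integrable.2
    ((hH.fst.continuous.integrableOn_Icc (a := a) (b := b)).mono_set Ioo_subset_Icc_self)
  refine ⟨hL.toLp U, ?_, ?_⟩
  · rw [L1.dist_eq_integral_dist]
    refine le_trans (le_of_eq ?_) hint
    rw [intervalIntegral.integral_of_le hab.le, integral_Ioc_eq_integral_Ioo]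
    refine integral_congr_ae ?_
    filter_upwards [hL.coeFn_toLp, hu] with x h1 h2
    rw [h1, h2, Real.dist_eq]
  · rw [energy_eq_scaledEnergy hH hab.le k ε hL.coeFn_toLp, EReal.coe_le_coe_iff, hE]
    have h1 : (F.card : ℝ) * scaledEnergy W k 1 U₀ V₀ w₀ s₀ t₀ ≤
        F.card * (M + δ / (F.card + 1)) := by gcongr
    have h2 : (F.card : ℝ) * (δ / (F.card + 1)) ≤ δ := by
      rw [← mul_div_assoc, div_le_iff₀ (by positivity)]
      nlinarith
    linarith

end Recovery

/-- A diagonal argument: approximate recovery sequences give a recovery sequence. -/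
theorem exists_tendsto_limsup_le {X : Type*} [PseudoMetricSpace X] {u : X} {G : ℕ → X → EReal}
    {A : ℝ} (h : ∀ δ : ℝ, 0 < δ → ∀ᶠ n in atTop, ∃ v, dist v u ≤ δ ∧ G n v ≤ ((A + δ : ℝ) : EReal)) :
    ∃ v : ℕ → X, Tendsto v atTop (𝓝 u) ∧ limsup (fun n => G n (v n)) atTop ≤ (A : EReal) := by
  classical
  set p : ℕ → ℕ → X → Prop := fun n m v =>
    dist v u ≤ 1 / ((m : ℝ) + 1) ∧ G n v ≤ ((A + 1 / ((m : ℝ) + 1) : ℝ) : EReal) with hp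
  -- The best accuracy `1 / (m + 1)` with `m ≤ n` that is attainable at index `n`. It eventually
  -- beats any fixed accuracy; the default `u` below only matters for indices where none is
  -- attained.
  set m : ℕ → ℕ := fun n => Nat.findGreatest (fun m => ∃ v, p n m v) n with hm
  set v : ℕ → X := fun n => if hv : ∃ v, p n (m n) v then hv.choose else u with hv
  have key : ∀ j : ℕ, ∀ᶠ n in atTop, p n j (v n) := by
    intro j
    filter_upwards [h (1 / ((j : ℝ) + 1)) (by positivity), eventually_ge_atTop j] with n hn hjn
    have h1 : ∃ v, p n (m n) v := Nat.findGreatest_spec (P := fun m => ∃ v, p n m v) hjn hn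
    have h2 : j ≤ m n := Nat.le_findGreatest hjn hn
    have h3 : v n = h1.choose := dif_pos h1
    have h4 := h1.choose_spec
    rw [← h3] at h4
    have h5 : 1 / ((m n : ℝ) + 1) ≤ 1 / ((j : ℝ) + 1) := by gcongr
    exact ⟨h4.1.trans h5, h4.2.trans (EReal.coe_le_coe_iff.2 (by linarith))⟩
  refine ⟨v, Metric.tendsto_atTop'.2 fun r hr => ?_, ?_⟩
  · obtain ⟨j, hj⟩ := exists_nat_one_div_lt hr
    obtain ⟨N, hN⟩ := eventually_atTop.1 (key j)
    exact ⟨N, fun n hn => (hN n hn.le).1.trans_lt hj⟩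
  · refine EReal.le_of_forall_lt_iff_le.1 fun z hz => ?_
    rw [EReal.coe_lt_coe_iff] at hz
    obtain ⟨j, hj⟩ := exists_nat_one_div_lt (sub_pos.2 hz)
    refine limsup_le_of_le (by isBoundedDefault) ((key j).mono fun n hn => hn.2.trans ?_)
    exact EReal.coe_le_coe_iff.2 (by linarith)

theorem exists_recovery_sequence {W : ℝ → ℝ} (hW : IsDoubleWell W) {k M : ℝ}
    (hM : optimalProfile W k = (M : EReal)) {a b : ℝ} (hab : a < b) {ε : ℕ → ℝ}
    (hε : ∀ n, 0 < ε n) (hε0 : Tendsto ε atTop (𝓝 0)) (u : L1 a b) :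
    ∃ v : ℕ → L1 a b, Tendsto v atTop (𝓝 u) ∧
      limsup (fun n => energy W k a b (ε n) (v n)) atTop ≤ limitEnergy W k a b u := by
  by_cases hu : MemBVSign u
  · have hF := hu.finite_essJump.coe_toFinset
    rw [limitEnergy_eq hab W k hF, hM, ← EReal.coe_mul, mul_comm]
    have hε' : Tendsto ε atTop (𝓝[>] 0) :=
      tendsto_nhdsWithin_iff.2 ⟨hε0, Eventually.of_forall hε⟩
    exact exists_tendsto_limsup_le fun δ hδ =>
      hε'.eventually (eventually_exists_energy_le hW k hM hab hF hδ)
  -- The limit energy is `+∞` here, so any sequence converging to `u` will do.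
  · refine ⟨fun _ => u, tendsto_const_nhds, ?_⟩
    rw [limitEnergy, if_neg hu]
    exact le_top

end ColemanMizel

end

theorem theorem4p1 (W : ℝ → ℝ) (hW : ColemanMizel.IsDoubleWell W) (a b : ℝ) (hab : a < b) :
    (∃ k₀ : ℝ, 0 < k₀ ∧ ColemanMizel.IsInterpolationConstant W k₀) ∧
    ∀ k₀ : ℝ, 0 < k₀ → ColemanMizel.IsInterpolationConstant W k₀ →
      ∀ k : ℝ, k < k₀ →
        0 < ColemanMizel.optimalProfile W k ∧ ColemanMizel.optimalProfile W k < ⊤ ∧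
        ColemanMizel.GammaConverges
          (fun ε : ℝ => ColemanMizel.energy W k a b ε)
          (ColemanMizel.limitEnergy W k a b) := by
  refine ⟨hW.exists_isInterpolationConstant, fun k₀ hk₀ hk k hkk => ?_⟩
  obtain ⟨M, hM, hMe⟩ := ColemanMizel.exists_optimalProfile_eq hW hk₀ hk hkk
  refine ⟨by rw [hMe]; exact_mod_cast hM, by rw [hMe]; exact EReal.coe_lt_top M,
    fun ε hε hε0 => ⟨fun u v hv => ?_, fun u => ?_⟩⟩
  · exact ColemanMizel.limitEnergy_le_liminf hW hk₀ hk hkk hab hε hε0 hv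
  · exact ColemanMizel.exists_recovery_sequence hW hMe hab hε hε0 u
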